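/- Let $(M,g)$ be a smooth oriented four-dimensional spacetime of signature $(-+++)$, with Levi-Civita connection $\nabla$, volume element $\eta$, Hodge dual $*$ (so $(*F)_{ab}=\frac12 F^{cd}\eta_{cdab}$ for a 2-form $F$), codifferential $\delta=*d*$ (so $(\delta F)_b=-\nabla^aF_{ab}$), and interior product $(i(\alpha)F)_b=\alpha^aF_{ab}$. Let $U$ be a smooth unitary 2-form on $M$, that is, at each point $U$ is the volume element of a time-like plane. Put $\mathcal U=\frac1{\sqrt2}(U-\mathrm i\,{*U})$, $\mathcal G=\frac12(G-\mathrm i\,\eta)$ with $G_{abcd}=g_{ac}g_{bd}-g_{ad}g_{bc}$, and $$\Sigma[U]=\nabla\mathcal U-i(\delta\mathcal U)\mathcal U\otimes\mathcal U-i(\delta\mathcal U)\mathcal G,\qquad \Phi[U]=i(\delta U)U-i(\delta{*U}){*U},\qquad \Psi[U]=-i(\delta U){*U}-i(\delta{*U})U .$$ A Killing-Yano (KY) tensor is a smooth 2-form $A$ with $\nabla_{(a}A_{b)c}=0$; a 2-form $A$ is regular if at each point $A_{ab}A^{ab}\neq0$ or $A_{ab}(*A)^{ab}\ne0$. We say that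 $U$ defines a KY structure if every point has a neighbourhood on which $A=e^{\phi}(\cos\psi\,U+\sin\psi\,{*U})$ is a regular KY tensor for some smooth functions $\phi,\psi$, and that the structure is non-product if $\nabla U$ vanishes at no point. Let $$\psi[U]=-\arctan\left\{\frac{i(x)\delta U}{i(x)\delta{*U}}\right\},$$ where $x$ is an arbitrary vector with $i(x)\delta U\neq0$ or $i(x)\delta{*U}\ne0$. Here the arctangent is taken modulo $\pi$, with the value $\frac{\pi}{2}$ when the denominator vanishes, and $\psi[U]$ stands for any smooth local function that agrees with this expression modulo $\pi$. **Theorem.** The 2-form $U$ defines a non-product KY structure if and only if $$\Sigma[U]=0,\qquad d\Phi[U]=0,\qquad \delta U\wedge\delta{*U}=0,\qquad 2\,d\psi[U]+\Psi[U]=0,$$ where the last condition includes that $\psi[U]$ is defined around every point (in particular that $\delta U$ and $\delta{*U}$ nowhere vanish simultaneously) and is required of every local determination of $\psi[U]$. Given a solution $U$ of these equations, around every point there exists a smooth function $\phi$ with $-2\,d\phi=\Phi[U]$; and on every open subset of a coordinate domain on which such a $\phi$ and a determination of $\psi[U]$ are defined, $A=e^{\phi}\{\cos\psi[U]\,U+\sin\psi[U]\,{*U}\}$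 is a regular KY tensor. -/

import Mathlib

open scoped Manifold ContDiff Topology

noncomputable section

namespace KillingYano

/-! ### Tensor calculus of a metric in a coordinate domain

A chart has values in `Coord`. Inside a chart a covariant 2-tensor is its matrix of components
`y ↦ (T_{ab}(y))`. The metric is denoted `g`, and all index positions below are covariant unless
they are contracted with the inverse metric. -/

/-- The coordinate space. -/
abbrev Coord : Type := EuclideanSpace ℝ (Fin 4)

/-- Components of a covariant 2-tensor in a coordinate domain. -/
abbrev Tensor2 : Type := Coord → Matrix (Fin 4) (Fin 4) ℝ

/-- Components of a 1-form in a coordinate domain. -/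
abbrev OneForm : Type := Coord → Fin 4 → ℝ

/-- The coordinate vector field with index `k`. -/
def coordVec (k : Fin 4) : Coord := EuclideanSpace.single k 1

/-- The partial derivative `∂_k f (y)`. -/
def pd (f : Coord → ℝ) (k : Fin 4) (y : Coord) : ℝ := fderiv ℝ f y (coordVec k)

/-- The Christoffel symbols `Γ^k_{ij}` of the Levi-Civita connection. -/
def christoffel (g : Tensor2) (y : Coord) (k i j : Fin 4) : ℝ :=
  (1 / 2) * ∑ l, (g y)⁻¹ k l *
    (pd (fun z => g z j l) i y + pd (fun z => g z i l) j y - pd (fun z => g z i j) l y)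

/-- The covariant derivative `∇_c T_{ab}`. -/
def cov (g T : Tensor2) (y : Coord) (c a b : Fin 4) : ℝ :=
  pd (fun z => T z a b) c y
    - ∑ d, christoffel g y d c a * T y d b - ∑ d, christoffel g y d c b * T y a d

/-- The Levi-Civita symbol. -/
def leviCivita (a b c d : Fin 4) : ℝ :=
  Matrix.det (Matrix.of fun r s : Fin 4 => if ![a, b, c, d] r = s then (1 : ℝ) else 0)

/-- The metric volume element `η_{abcd}` (in a positively oriented chart). -/
def vol (g : Tensor2) (y : Coord) (a b c d : Fin 4) : ℝ :=
  Real.sqrt |(g y).det| * leviCivita a b c d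

/-- Raising the index of a 1-form: `α^a`. -/
def raise1 (g : Tensor2) (y : Coord) (α : Fin 4 → ℝ) (a : Fin 4) : ℝ :=
  ∑ p, (g y)⁻¹ a p * α p

/-- Raising both indices of a 2-tensor: `F^{ab}`. -/
def raise2 (g F : Tensor2) (y : Coord) (a b : Fin 4) : ℝ :=
  ∑ p, ∑ q, (g y)⁻¹ a p * (g y)⁻¹ b q * F y p q

/-- The Hodge dual of a 2-form: `(*F)_{ab} = (1/2) F^{cd} η_{cdab}`. -/
def hodge2 (g F : Tensor2) : Tensor2 := fun y => Matrix.of fun a b =>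
  (1 / 2) * ∑ c, ∑ d, raise2 g F y c d * vol g y c d a b

/-- The exterior derivative of a 2-form: `(dF)_{abc} = ∂_a F_{bc} + ∂_b F_{ca} + ∂_c F_{ab}`. -/
def extDeriv2 (F : Tensor2) (y : Coord) (a b c : Fin 4) : ℝ :=
  pd (fun z => F z b c) a y + pd (fun z => F z c a) b y + pd (fun z => F z a b) c y

/-- The Hodge dual of a 3-form: `(*β)_d = (1/6) β^{abc} η_{abcd}`. -/
def hodge3 (g : Tensor2) (β : Coord → Fin 4 → Fin 4 → Fin 4 → ℝ) : OneForm := fun y d =>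
  (1 / 6) * ∑ a, ∑ b, ∑ c,
    (∑ p, ∑ q, ∑ r, (g y)⁻¹ a p * (g y)⁻¹ b q * (g y)⁻¹ c r * β y p q r) * vol g y a b c d

/-- The exterior codifferential of a 2-form, `δ = * d *`. -/
def codiff (g F : Tensor2) : OneForm := hodge3 g (extDeriv2 (hodge2 g F))

/-- The interior product `(i(α)T)_b = α^a T_{ab}`. -/
def interior (g : Tensor2) (α : OneForm) (T : Tensor2) : OneForm := fun y b =>
  ∑ a, raise1 g y (α y) a * T y a b

/-- The 1-form `Φ[U] = i(δU)U - i(δ*U)*U`. -/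
def phiForm (g U : Tensor2) : OneForm := fun y b =>
  interior g (codiff g U) U y b - interior g (codiff g (hodge2 g U)) (hodge2 g U) y b

/-- The 1-form `Ψ[U] = -i(δU)*U - i(δ*U)U`. -/
def psiForm (g U : Tensor2) : OneForm := fun y b =>
  - interior g (codiff g U) (hodge2 g U) y b - interior g (codiff g (hodge2 g U)) U y b

/-- The self-dual 2-form `(1/√2)(U - i *U)`. -/
def selfDual (g U : Tensor2) (y : Coord) (a b : Fin 4) : ℂ :=
  (1 / Real.sqrt 2 : ℝ) * ((U y a b : ℂ) - Complex.I * (hodge2 g U y a b : ℂ))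

/-- The covariant derivative of `(1/√2)(U - i *U)`. -/
def covSelfDual (g U : Tensor2) (y : Coord) (c a b : Fin 4) : ℂ :=
  (1 / Real.sqrt 2 : ℝ) * ((cov g U y c a b : ℂ) - Complex.I * (cov g (hodge2 g U) y c a b : ℂ))

/-- The codifferential of `(1/√2)(U - i *U)`. -/
def codiffSelfDual (g U : Tensor2) (y : Coord) (a : Fin 4) : ℂ :=
  (1 / Real.sqrt 2 : ℝ) * ((codiff g U y a : ℂ) - Complex.I * (codiff g (hodge2 g U) y a : ℂ))

/-- The vector obtained from the codifferential of `(1/√2)(U - i *U)` by raising its index. -/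
def codiffSelfDualUp (g U : Tensor2) (y : Coord) (d : Fin 4) : ℂ :=
  ∑ p, (((g y)⁻¹ d p : ℝ) : ℂ) * codiffSelfDual g U y p

/-- The metric of the space of self-dual 2-forms, `(1/2)(G - i η)`, where
`G_{abcd} = g_{ac} g_{bd} - g_{ad} g_{bc}`. -/
def selfDualMetric (g : Tensor2) (y : Coord) (a b c d : Fin 4) : ℂ :=
  (1 / 2) * (((g y a c * g y b d - g y a d * g y b c : ℝ) : ℂ) - Complex.I * (vol g y a b c d : ℂ))

/-- The umbilicity tensor `Σ[U] = ∇𝒰 - i(δ𝒰)𝒰 ⊗ 𝒰 - i(δ𝒰)𝒢`. -/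
def sigmaTensor (g U : Tensor2) (y : Coord) (c a b : Fin 4) : ℂ :=
  covSelfDual g U y c a b
    - (∑ d, codiffSelfDualUp g U y d * selfDual g U y d c) * selfDual g U y a b
    - ∑ d, codiffSelfDualUp g U y d * selfDualMetric g y d c a b

/-- `-arctan (a / b)`, with the convention that the arctangent of `a / 0` is `-π/2`
(equivalently `π/2`: the value only matters modulo `π`). -/
def negArctan (a b : ℝ) : ℝ := if b = 0 then Real.pi / 2 else - Real.arctan (a / b)

/-- `ψ` is a smooth determination on `W` of `ψ[U] = -arctan (i(x)δU / i(x)δ*U)`, computed with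
the vectors `x`, for which `i(x)δU` and `i(x)δ*U` never vanish simultaneously. The arctangent is
understood modulo `π`. -/
structure IsRainichIndexOn (g U : Tensor2) (W : Set Coord) (x : Coord → Fin 4 → ℝ)
    (ψ : Coord → ℝ) : Prop where
  smooth : ContDiffOn ℝ ∞ ψ W
  ne_zero : ∀ y ∈ W, ∑ a, x y a * codiff g U y a ≠ 0 ∨
    ∑ a, x y a * codiff g (hodge2 g U) y a ≠ 0
  eq_negArctan : ∀ y ∈ W, ∃ n : ℤ, ψ y =
    negArctan (∑ a, x y a * codiff g U y a) (∑ a, x y a * codiff g (hodge2 g U) y a) + n * Real.pi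

/-- `φ` is a smooth solution on `W` of `-2 dφ = Φ[U]`. -/
structure IsEnergeticIndexOn (g U : Tensor2) (W : Set Coord) (φ : Coord → ℝ) : Prop where
  smooth : ContDiffOn ℝ ∞ φ W
  eq_phiForm : ∀ y ∈ W, ∀ a, -2 * pd φ a y = phiForm g U y a

/-- The 2-form `e^φ (cos ψ U + sin ψ *U)`. -/
def canonicalForm (g U : Tensor2) (φ ψ : Coord → ℝ) : Tensor2 := fun y =>
  Real.exp (φ y) • (Real.cos (ψ y) • U y + Real.sin (ψ y) • hodge2 g U y)

/-- `A` is a Killing-Yano tensor on `W`: a smooth 2-form with `∇_{(a} A_{b)c} = 0`. -/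
structure IsKillingYanoOn (g A : Tensor2) (W : Set Coord) : Prop where
  smooth : ∀ a b, ContDiffOn ℝ ∞ (fun y => A y a b) W
  skew : ∀ y ∈ W, ∀ a b, A y a b = - A y b a
  killing : ∀ y ∈ W, ∀ a b c, cov g A y a b c + cov g A y b a c = 0

/-- The 2-form `A` is regular (non-null) on `W`: its two scalar invariants `A_{ab} A^{ab}` and
`A_{ab} (*A)^{ab}` do not vanish simultaneously. -/
def IsRegularOn (g A : Tensor2) (W : Set Coord) : Prop :=
  ∀ y ∈ W, ∑ a, ∑ b, A y a b * raise2 g A y a b ≠ 0 ∨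
    ∑ a, ∑ b, A y a b * raise2 g (hodge2 g A) y a b ≠ 0

/-! ### Spacetimes -/

/-- A field of bilinear forms (covariant 2-tensors) on a 4-manifold. -/
abbrev BilinField (M : Type*) [TopologicalSpace M] [ChartedSpace Coord M] : Type _ :=
  ∀ p : M, TangentSpace (𝓡 4) p →L[ℝ] TangentSpace (𝓡 4) p →L[ℝ] ℝ

section Manifold

variable {M : Type*} [TopologicalSpace M] [ChartedSpace Coord M]

/-- The components of a covariant 2-tensor field in a chart. -/
def comp (e : OpenPartialHomeomorph M Coord) (T : BilinField M) : Tensor2 := fun y =>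
  Matrix.of fun a b =>
    T (e.symm y) (mfderiv (𝓡 4) (𝓡 4) e.symm y (coordVec a))
      (mfderiv (𝓡 4) (𝓡 4) e.symm y (coordVec b))

variable (M) in
/-- The charts of the atlas are coherently oriented; they are the positively oriented charts. -/
def IsOrientedAtlas : Prop :=
  ∀ e ∈ atlas Coord M, ∀ e' ∈ atlas Coord M, ∀ y ∈ (e.symm.trans e').source,
    0 < (fderiv ℝ (e.symm.trans e') y).det

/-- A covariant 2-tensor field is smooth. -/
def IsSmoothField (T : BilinField M) : Prop :=
  ∀ e ∈ atlas Coord M, ∀ a b, ContDiffOn ℝ ∞ (fun y => comp e T y a b) e.target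

/-- `g` is a smooth metric of signature `(-+++)`. -/
structure IsLorentzMetric (g : BilinField M) : Prop where
  smooth : IsSmoothField g
  signature : ∀ p : M, ∃ b : Module.Basis (Fin 4) ℝ (TangentSpace (𝓡 4) p), ∀ i j,
    g p (b i) (b j) = if i = j then (if i = 0 then -1 else 1) else 0

/-- `U` is a smooth unitary 2-form: at each point it is the volume element of a time-like
plane, the plane spanned by the orthonormal vectors `u` (time-like) and `w` (space-like). -/
structure IsUnitaryTwoForm (g U : BilinField M) : Prop where
  smooth : IsSmoothField U
  unitary : ∀ p : M, ∃ u w : TangentSpace (𝓡 4) p,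
    g p u u = -1 ∧ g p w w = 1 ∧ g p u w = 0 ∧
      ∀ a b, U p a b = g p u a * g p w b - g p u b * g p w a

/-! All the notions below are local; they are required in each chart of the atlas. -/

/-- `U` defines a Killing-Yano structure: around each point it is the canonical 2-form of a
regular Killing-Yano tensor `A = e^φ (cos ψ U + sin ψ *U)`. -/
def IsKillingYanoStructure (g U : BilinField M) : Prop :=
  ∀ e ∈ atlas Coord M, ∀ y ∈ e.target, ∃ W : Set Coord, IsOpen W ∧ y ∈ W ∧ W ⊆ e.target ∧
    ∃ φ ψ : Coord → ℝ, ContDiffOn ℝ ∞ φ W ∧ ContDiffOn ℝ ∞ ψ W ∧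
      IsKillingYanoOn (comp e g) (canonicalForm (comp e g) (comp e U) φ ψ) W ∧
      IsRegularOn (comp e g) (canonicalForm (comp e g) (comp e U) φ ψ) W

/-- The structure is non-product: `∇U` vanishes at no point. -/
def IsNonProduct (g U : BilinField M) : Prop :=
  ∀ e ∈ atlas Coord M, ∀ y ∈ e.target, ∃ c a b, cov (comp e g) (comp e U) y c a b ≠ 0

/-- `Σ[U] = 0`. -/
def IsUmbilical (g U : BilinField M) : Prop :=
  ∀ e ∈ atlas Coord M, ∀ y ∈ e.target, ∀ c a b, sigmaTensor (comp e g) (comp e U) y c a b = 0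

/-- `dΦ[U] = 0`. -/
def PhiClosed (g U : BilinField M) : Prop :=
  ∀ e ∈ atlas Coord M, ∀ y ∈ e.target, ∀ a b,
    pd (fun z => phiForm (comp e g) (comp e U) z b) a y
      - pd (fun z => phiForm (comp e g) (comp e U) z a) b y = 0

/-- `δU ∧ δ*U = 0`. -/
def CodiffWedgeZero (g U : BilinField M) : Prop :=
  ∀ e ∈ atlas Coord M, ∀ y ∈ e.target, ∀ a b,
    codiff (comp e g) (comp e U) y a * codiff (comp e g) (hodge2 (comp e g) (comp e U)) y b
      - codiff (comp e g) (comp e U) y b * codiff (comp e g) (hodge2 (comp e g) (comp e U)) y a = 0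

/-- `2 dψ[U] + Ψ[U] = 0`: around each point there is a smooth determination of `ψ[U]`, and all of
them, for all choices of the vectors `x`, satisfy the equation. -/
def RainichEquation (g U : BilinField M) : Prop :=
  ∀ e ∈ atlas Coord M,
    (∀ y ∈ e.target, ∃ W : Set Coord, IsOpen W ∧ y ∈ W ∧ W ⊆ e.target ∧
      ∃ x ψ, IsRainichIndexOn (comp e g) (comp e U) W x ψ) ∧
    ∀ W : Set Coord, IsOpen W → W ⊆ e.target →
      ∀ x ψ, IsRainichIndexOn (comp e g) (comp e U) W x ψ →
        ∀ y ∈ W, ∀ a, 2 * pd ψ a y + psiForm (comp e g) (comp e U) y a = 0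

end Manifold

end KillingYano

end

open KillingYano

/-!
Write `V = *U` and `𝒰 = (U - i V) / √2`. The form `A = e^φ (cos ψ U + sin ψ V)` is the real part of
`√2 e^{φ + iψ} 𝒰`. The Killing-Yano equation for `A` is the conformal Killing-Yano equation for this
self-dual form together with `δA = 0`. The former amounts to `Σ[U] = 0` and
`-2 d(φ + iψ) = Φ[U] + i Ψ[U]`; given these, the latter amounts to `cos ψ δU + sin ψ δV = 0`, which
says that `δU` and `δV` are proportional and that `tan ψ` is minus their ratio, that is, `ψ` is a
determination of `ψ[U]`. Local solutions `φ` and `ψ` exist exactly when `Φ[U]` is closed and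
`2 dψ[U] + Ψ[U] = 0`.

The proof has a differential and an algebraic part. The differential part expresses everything
through the metric, `U` and `T = ∇U` at a point. A function of a metric and a 2-tensor that is
invariant under changes of basis is differentiated by differentiating along `∇F` only
(`pd_eq_add_of_hasDerivAt`), because `∂_c g` is the infinitesimal change of basis given by the
Christoffel symbols. Since the Hodge dual commutes with changes of basis (`hodgeAt_conj`), this
yields `∇*U = *∇U` (`covMatrix_hodge`), the orthogonality of `∇U` to `U` and `V`, and
`(δF)_b = -∇^a F_{ab}` (`codiff_eq_negDiv`).

The algebraic part is pointwise. In a frame adapted to `U` (`hasAdaptedFrame_of_plane`) the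
Killing-Yano equation is a linear system with a four-parameter solution (`exists_parameters`), from
which the equations are read off (`HasAdaptedFrame.of_isKillingAt`). Conversely, under the equations
`∇A` is the contraction of the volume element with a 1-form, hence antisymmetric
(`HasAdaptedFrame.isKillingAt`). The tensor `Σ[U]` is self-dual in its last two indices, so its real
part carries all the information (`sigmaTensor_eq`). A potential of `Φ[U]` comes from the Poincaré
lemma, and two determinations of `ψ[U]` have the same differential because they differ by multiples
of `π` (`pd_eq_of_comb`).
-/

namespace KillingYano

open Matrix

/-! ### The Hodge dual at a point -/

/-- The Hodge dual at a point: `hodge2` of constant component fields. -/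
noncomputable def hodgeAt (G F : Matrix (Fin 4) (Fin 4) ℝ) : Matrix (Fin 4) (Fin 4) ℝ :=
  hodge2 (fun _ => G) (fun _ => F) 0

theorem hodge2_apply (g F : Tensor2) (y : Coord) : hodge2 g F y = hodgeAt (g y) (F y) := rfl

/-- A closed form of the Levi-Civita symbol: multiplying the determinant that defines it by the
Vandermonde determinant of `0, 1, 2, 3` gives the Vandermonde determinant of its indices. -/
theorem leviCivita_eq (a b c d : Fin 4) :
    leviCivita a b c d = ((b : ℝ) - a) * (c - a) * (d - a) * (c - b) * (d - b) * (d - c) / 12 := by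
  have h := congrArg Matrix.det (show
    (Matrix.of fun r s : Fin 4 => if ![a, b, c, d] r = s then (1 : ℝ) else 0) *
      vandermonde (fun i : Fin 4 => (i : ℝ)) =
        vandermonde (fun i => ((![a, b, c, d] i : Fin 4) : ℝ))
    from by
      ext i j
      simp [Matrix.mul_apply, vandermonde_apply])
  rw [det_mul, det_vandermonde, det_vandermonde] at h
  have e0 : Finset.Ioi (0 : Fin 4) = {1, 2, 3} := by decide
  have e1 : Finset.Ioi (1 : Fin 4) = {2, 3} := by decide
  have e2 : Finset.Ioi (2 : Fin 4) = {3} := by decide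
  have e3 : Finset.Ioi (3 : Fin 4) = ∅ := by decide
  simp [Fin.prod_univ_four, e0, e1, e2, e3] at h
  rw [leviCivita, eq_div_iff (by norm_num)]
  linear_combination h

/-- A sum over maps `Fin 4 → Fin 4` as an iterated sum. -/
theorem sum_fin_four_fun (f : (Fin 4 → Fin 4) → ℝ) :
    ∑ r, f r = ∑ a, ∑ b, ∑ c, ∑ d, f ![a, b, c, d] := by
  let e : (Fin 4 → Fin 4) ≃ Fin 4 × Fin 4 × Fin 4 × Fin 4 :=
    { toFun := fun v => (v 0, v 1, v 2, v 3)
      invFun := fun p => ![p.1, p.2.1, p.2.2.1, p.2.2.2]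
      left_inv := fun v => by ext i; fin_cases i <;> rfl
      right_inv := fun p => rfl }
  rw [← e.symm.sum_comp, Fintype.sum_prod_type]
  simp only [Fintype.sum_prod_type]
  rfl

/-- The Levi-Civita symbol is a tensor density: it transforms by the determinant. -/
theorem sum_leviCivita_mul (P : Matrix (Fin 4) (Fin 4) ℝ) (i j k l : Fin 4) :
    ∑ a, ∑ b, ∑ c, ∑ d, P a i * P b j * P c k * P d l * leviCivita a b c d =
      P.det * leviCivita i j k l := by
  have h1 : (Matrix.of fun r s : Fin 4 => P s (![i, j, k, l] r)).det =
      P.det * leviCivita i j k l := by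
    rw [leviCivita, mul_comm, ← det_transpose P, ← det_mul]
    congr 1
    ext r s
    simp [Matrix.mul_apply]
  have h2 : (Matrix.of fun r s : Fin 4 => P s (![i, j, k, l] r)) =
      Matrix.of fun r => ∑ a, P a (![i, j, k, l] r) • (fun s => if a = s then (1 : ℝ) else 0) := by
    ext r s
    simp
  have h3 : (Matrix.of fun r => ∑ a, P a (![i, j, k, l] r) •
      (fun s => if a = s then (1 : ℝ) else 0)).det =
      ∑ v : Fin 4 → Fin 4, (Matrix.of fun r => P (v r) (![i, j, k, l] r) •
        (fun s => if v r = s then (1 : ℝ) else 0)).det :=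
    (Matrix.detRowAlternating (n := Fin 4) (R := ℝ)).toMultilinearMap.map_sum
      (fun r a => P a (![i, j, k, l] r) • (fun s => if a = s then (1 : ℝ) else 0))
  have h4 : ∀ v : Fin 4 → Fin 4, (Matrix.of fun r => P (v r) (![i, j, k, l] r) •
        (fun s => if v r = s then (1 : ℝ) else 0)).det = (∏ r, P (v r) (![i, j, k, l] r)) *
          (Matrix.of fun r s => if v r = s then (1 : ℝ) else 0).det := fun v =>
    (Matrix.detRowAlternating (n := Fin 4) (R := ℝ)).toMultilinearMap.map_smul_univ
      (fun r => P (v r) (![i, j, k, l] r)) (fun r s => if v r = s then (1 : ℝ) else 0)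
  rw [← h1, h2, h3, Finset.sum_congr rfl fun v _ => h4 v, sum_fin_four_fun]
  refine Finset.sum_congr rfl fun a _ => Finset.sum_congr rfl fun b _ =>
    Finset.sum_congr rfl fun c _ => Finset.sum_congr rfl fun d _ => ?_
  rw [Fin.prod_univ_four]
  rfl

/-- The dual `(1/2) R^{cd} ε_{cdab}` of a contravariant 2-tensor. -/
noncomputable def epsDual (R : Matrix (Fin 4) (Fin 4) ℝ) : Matrix (Fin 4) (Fin 4) ℝ :=
  Matrix.of fun a b => (1 / 2) * ∑ c, ∑ d, R c d * leviCivita c d a b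

theorem hodgeAt_eq (G F : Matrix (Fin 4) (Fin 4) ℝ) :
    hodgeAt G F = Real.sqrt |G.det| • epsDual (G⁻¹ * F * G⁻¹ᵀ) := by
  ext a b
  simp only [hodgeAt, hodge2, raise2, vol, epsDual, Matrix.of_apply, Matrix.smul_apply,
    smul_eq_mul, Matrix.mul_apply, Matrix.transpose_apply, Finset.sum_mul, Finset.mul_sum]
  refine Finset.sum_congr rfl fun c _ => Finset.sum_congr rfl fun d _ => ?_
  rw [Finset.sum_comm]
  refine Finset.sum_congr rfl fun p _ => Finset.sum_congr rfl fun q _ => ?_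
  ring

theorem sum_six_reverse (f : Fin 4 → Fin 4 → Fin 4 → Fin 4 → Fin 4 → Fin 4 → ℝ) :
    ∑ b, ∑ a, ∑ c, ∑ d, ∑ j, ∑ i, f i j c d a b = ∑ i, ∑ j, ∑ c, ∑ d, ∑ a, ∑ b, f i j c d a b := by
  let e : (Fin 4 × Fin 4 × Fin 4 × Fin 4 × Fin 4 × Fin 4) ≃
      (Fin 4 × Fin 4 × Fin 4 × Fin 4 × Fin 4 × Fin 4) :=
    { toFun := fun p => (p.2.2.2.2.2, p.2.2.2.2.1, p.2.2.1, p.2.2.2.1, p.2.1, p.1)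
      invFun := fun p => (p.2.2.2.2.2, p.2.2.2.2.1, p.2.2.1, p.2.2.2.1, p.2.1, p.1)
      left_inv := fun _ => rfl
      right_inv := fun _ => rfl }
  have h := e.sum_comp fun p => f p.1 p.2.1 p.2.2.1 p.2.2.2.1 p.2.2.2.2.1 p.2.2.2.2.2
  simp only [Fintype.sum_prod_type] at h
  exact h

theorem epsDual_conj (P R : Matrix (Fin 4) (Fin 4) ℝ) :
    Pᵀ * epsDual (P * R * Pᵀ) * P = P.det • epsDual R := by
  ext k l
  have h : P.det * (1 / 2 * ∑ i, ∑ j, R i j * leviCivita i j k l) =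
      1 / 2 * ∑ i, ∑ j, R i j * (P.det * leviCivita i j k l) := by
    simp only [Finset.mul_sum]
    refine Finset.sum_congr rfl fun c _ => Finset.sum_congr rfl fun d _ => ?_
    ring
  simp only [epsDual, Matrix.smul_apply, Matrix.of_apply, smul_eq_mul]
  rw [h]
  simp only [← sum_leviCivita_mul, Matrix.mul_apply, Matrix.transpose_apply, Matrix.of_apply,
    Finset.sum_mul, Finset.mul_sum]
  rw [← sum_six_reverse]
  refine Finset.sum_congr rfl fun b _ => Finset.sum_congr rfl fun a _ =>
    Finset.sum_congr rfl fun c _ => Finset.sum_congr rfl fun d _ =>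
    Finset.sum_congr rfl fun j _ => Finset.sum_congr rfl fun i _ => ?_
  ring

/-- The Hodge dual commutes with orientation-preserving changes of the basis. -/
theorem hodgeAt_conj (P G F : Matrix (Fin 4) (Fin 4) ℝ) (hP : 0 < P.det) :
    hodgeAt (Pᵀ * G * P) (Pᵀ * F * P) = Pᵀ * hodgeAt G F * P := by
  have hu : IsUnit P.det := hP.ne'.isUnit
  have hu' : IsUnit Pᵀ.det := by rwa [det_transpose]
  have hR : P * ((Pᵀ * G * P)⁻¹ * (Pᵀ * F * P) * ((Pᵀ * G * P)⁻¹)ᵀ) * Pᵀ = G⁻¹ * F * G⁻¹ᵀ := by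
    simp only [Matrix.mul_inv_rev, Matrix.transpose_mul, Matrix.transpose_nonsing_inv,
      Matrix.transpose_transpose, ← Matrix.mul_assoc]
    rw [Matrix.mul_nonsing_inv _ hu]
    simp only [Matrix.mul_assoc]
    rw [Matrix.nonsing_inv_mul _ hu', ← Matrix.mul_assoc Pᵀ⁻¹, Matrix.nonsing_inv_mul _ hu',
      ← Matrix.mul_assoc P P⁻¹, Matrix.mul_nonsing_inv _ hu]
    simp
  have hs : Real.sqrt |(Pᵀ * G * P).det| = Real.sqrt |G.det| * P.det := by
    rw [det_mul, det_mul, det_transpose, show P.det * G.det * P.det = G.det * P.det ^ 2 by ring,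
      abs_mul, Real.sqrt_mul (abs_nonneg _), abs_of_nonneg (sq_nonneg P.det),
      Real.sqrt_sq hP.le]
  rw [hodgeAt_eq, hodgeAt_eq, hs, ← hR, mul_smul, ← epsDual_conj, Matrix.mul_smul, Matrix.smul_mul]

theorem hodgeAt_add (G F H : Matrix (Fin 4) (Fin 4) ℝ) :
    hodgeAt G (F + H) = hodgeAt G F + hodgeAt G H := by
  ext a b
  simp [hodgeAt, hodge2, raise2, Finset.sum_add_distrib, mul_add, add_mul]

theorem hodgeAt_smul (G F : Matrix (Fin 4) (Fin 4) ℝ) (r : ℝ) :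
    hodgeAt G (r • F) = r • hodgeAt G F := by
  ext a b
  simp only [hodgeAt, hodge2, raise2, Matrix.of_apply, Matrix.smul_apply, smul_eq_mul,
    Finset.mul_sum, Finset.sum_mul]
  refine Finset.sum_congr rfl fun c _ => Finset.sum_congr rfl fun d _ =>
    Finset.sum_congr rfl fun p _ => Finset.sum_congr rfl fun q _ => ?_
  ring

theorem hodgeAt_zero (G : Matrix (Fin 4) (Fin 4) ℝ) : hodgeAt G 0 = 0 := by
  simpa using hodgeAt_smul G 0 0

theorem hodgeAt_skew (G F : Matrix (Fin 4) (Fin 4) ℝ) (a b : Fin 4) :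
    hodgeAt G F a b = - hodgeAt G F b a := by
  simp only [hodgeAt, hodge2, Matrix.of_apply, vol, leviCivita_eq]
  rw [← mul_neg, ← Finset.sum_neg_distrib]
  simp only [← Finset.sum_neg_distrib]
  congr 1
  refine Finset.sum_congr rfl fun c _ => Finset.sum_congr rfl fun d _ => ?_
  ring

/-- The Minkowski metric. -/
def minkowski : Matrix (Fin 4) (Fin 4) ℝ := Matrix.diagonal ![-1, 1, 1, 1]

theorem minkowski_mul_self : minkowski * minkowski = 1 := by
  rw [minkowski, Matrix.diagonal_mul_diagonal, ← Matrix.diagonal_one]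
  congr 1
  ext i
  fin_cases i <;> simp

theorem minkowski_inv : minkowski⁻¹ = minkowski := Matrix.inv_eq_left_inv minkowski_mul_self

theorem minkowski_det : minkowski.det = -1 := by
  simp [minkowski, Matrix.det_diagonal, Fin.prod_univ_four]

/-- The components of the Hodge dual in a positively oriented orthonormal basis. -/
theorem hodgeAt_minkowski (F : Matrix (Fin 4) (Fin 4) ℝ) (hF : ∀ a b, F a b = - F b a) :
    hodgeAt minkowski F =
      !![0, F 2 3, - F 1 3, F 1 2; - F 2 3, 0, - F 0 3, F 0 2; F 1 3, F 0 3, 0, - F 0 1;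
        - F 1 2, - F 0 2, F 0 1, 0] := by
  have hR : minkowski * F * minkowskiᵀ = Matrix.of fun a b =>
      (![-1, 1, 1, 1] : Fin 4 → ℝ) a * F a b * (![-1, 1, 1, 1] : Fin 4 → ℝ) b := by
    ext a b
    simp [minkowski, Matrix.diagonal_transpose]
  rw [hodgeAt_eq, minkowski_inv, hR, minkowski_det]
  have h10 := hF 1 0
  have h20 := hF 2 0
  have h30 := hF 3 0
  have h21 := hF 2 1
  have h31 := hF 3 1
  have h32 := hF 3 2
  ext a b
  simp only [epsDual, Matrix.smul_apply, Matrix.of_apply, leviCivita_eq, Fin.sum_univ_four]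
  fin_cases a <;> fin_cases b <;> simp <;> linarith

/-! ### Adapted frames -/

/-- The volume element of the plane spanned by the first two vectors of a positively oriented
orthonormal basis, in that basis. -/
def unitaryNormal : Matrix (Fin 4) (Fin 4) ℝ := !![0, -1, 0, 0; 1, 0, 0, 0; 0, 0, 0, 0; 0, 0, 0, 0]

/-- A spatial unit vector is the second vector of an orthonormal basis with first vector `∂_0`. -/
theorem exists_spatial_rotation (n : Fin 4 → ℝ) (h0 : n 0 = 0)
    (hn : n 1 ^ 2 + n 2 ^ 2 + n 3 ^ 2 = 1) :
    ∃ E : Matrix (Fin 4) (Fin 4) ℝ, Eᵀ * minkowski * E = minkowski ∧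
      E.col 0 = Pi.single 0 1 ∧ E.col 1 = n := by
  let v : EuclideanSpace ℝ (Fin 3) := !₂[n 1, n 2, n 3]
  have hv : Orthonormal ℝ (({0} : Set (Fin 3)).domRestrict fun _ => v) := by
    refine ⟨fun i => ?_, fun i j hij => absurd (Subsingleton.elim i j) hij⟩
    change ‖v‖ = 1
    rw [EuclideanSpace.norm_eq, Real.sqrt_eq_one]
    simp [Fin.sum_univ_three, v, hn]
  obtain ⟨b, hb⟩ := hv.exists_orthonormalBasis_extension_of_card_eq (by simp)
  have hb0 : b 0 = v := hb 0 rfl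
  have ho : ∀ i j, b i 0 * b j 0 + b i 1 * b j 1 + b i 2 * b j 2 = if i = j then 1 else 0 := by
    intro i j
    rw [← orthonormal_iff_ite.mp b.orthonormal i j, PiLp.inner_apply]
    simp only [Fin.sum_univ_three, RCLike.inner_apply, conj_trivial]
    ring
  refine ⟨!![1, 0, 0, 0; 0, b 0 0, b 1 0, b 2 0; 0, b 0 1, b 1 1, b 2 1;
    0, b 0 2, b 1 2, b 2 2], ?_, ?_, ?_⟩
  · ext i j
    fin_cases i <;> fin_cases j <;>
      simp [Matrix.mul_apply, Fin.sum_univ_four, minkowski, Matrix.diagonal, ho]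
  · ext i
    fin_cases i <;> simp
  · ext i
    fin_cases i <;> simp [hb0, v, h0]

/-- A future-directed unit time-like vector `u` is the first vector of an orthonormal basis: the
standard boost, with spatial block `δ_{ij} + u_i u_j / (1 + u_0)`. -/
theorem exists_boost (u : Fin 4 → ℝ) (hu : - u 0 ^ 2 + u 1 ^ 2 + u 2 ^ 2 + u 3 ^ 2 = -1)
    (h0 : 0 ≤ u 0) :
    ∃ E : Matrix (Fin 4) (Fin 4) ℝ, Eᵀ * minkowski * E = minkowski ∧ E.col 0 = u := by
  obtain ⟨m, hm⟩ : ∃ m : ℝ, m * (1 + u 0) = 1 := ⟨(1 + u 0)⁻¹, inv_mul_cancel₀ (by linarith)⟩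
  have hk : m * (u 1 ^ 2 + u 2 ^ 2 + u 3 ^ 2) = u 0 - 1 := by
    linear_combination m * hu + (u 0 - 1) * hm
  refine ⟨!![u 0, u 1, u 2, u 3;
    u 1, 1 + m * u 1 * u 1, m * u 1 * u 2, m * u 1 * u 3;
    u 2, m * u 2 * u 1, 1 + m * u 2 * u 2, m * u 2 * u 3;
    u 3, m * u 3 * u 1, m * u 3 * u 2, 1 + m * u 3 * u 3], ?_, ?_⟩
  · -- An off-diagonal spatial entry is `u_i u_j (-1 + 2 m + m (m |u|^2))`, and
    -- `m |u|^2 = u_0 - 1`.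
    have key : ∀ i j : Fin 4, -(u i * u j) + 2 * (m * u i * u j) +
        m * u i * u j * (m * (u 1 ^ 2 + u 2 ^ 2 + u 3 ^ 2)) = 0 := by
      intro i j
      rw [hk]
      linear_combination (u i * u j) * hm
    have key0 : ∀ i : Fin 4,
        -(u 0 * u i) + u i + u i * (m * (u 1 ^ 2 + u 2 ^ 2 + u 3 ^ 2)) = 0 := by
      intro i
      rw [hk]
      ring
    ext i j
    fin_cases i <;> fin_cases j <;>
      simp [Matrix.mul_apply, Fin.sum_univ_four, minkowski, Matrix.diagonal]
    · linear_combination hu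
    · linear_combination key0 1
    · linear_combination key0 2
    · linear_combination key0 3
    · linear_combination key0 1
    · linear_combination key 1 1
    · linear_combination key 1 2
    · linear_combination key 1 3
    · linear_combination key0 2
    · linear_combination key 2 1
    · linear_combination key 2 2
    · linear_combination key 2 3
    · linear_combination key0 3
    · linear_combination key 3 1
    · linear_combination key 3 2
    · linear_combination key 3 3
  · ext i
    fin_cases i <;> simp

theorem dotProduct_minkowski (u w : Fin 4 → ℝ) :
    u ⬝ᵥ minkowski *ᵥ w = - (u 0 * w 0) + u 1 * w 1 + u 2 * w 2 + u 3 * w 3 := by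
  simp [minkowski, Matrix.mulVec_diagonal, dotProduct, Fin.sum_univ_four]

theorem dotProduct_conj (E G : Matrix (Fin 4) (Fin 4) ℝ) (u w : Fin 4 → ℝ) :
    u ⬝ᵥ (Eᵀ * G * E) *ᵥ w = (E *ᵥ u) ⬝ᵥ G *ᵥ (E *ᵥ w) := by
  rw [← Matrix.mulVec_mulVec, ← Matrix.mulVec_mulVec, Matrix.dotProduct_mulVec,
    Matrix.vecMul_transpose]

theorem isUnit_det_of_conj_eq_minkowski {E G : Matrix (Fin 4) (Fin 4) ℝ}
    (h : Eᵀ * G * E = minkowski) : IsUnit E.det ∧ IsUnit G.det := by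
  have h1 := congrArg Matrix.det h
  rw [det_mul, det_mul, minkowski_det] at h1
  constructor <;> refine isUnit_iff_ne_zero.mpr fun h2 => ?_ <;> simp [h2] at h1

/-- An orthonormal pair, time-like and space-like, extends to an orthonormal basis of Minkowski
space. -/
theorem exists_lorentz_frame (u w : Fin 4 → ℝ) (hu : u ⬝ᵥ minkowski *ᵥ u = -1)
    (hw : w ⬝ᵥ minkowski *ᵥ w = 1) (huw : u ⬝ᵥ minkowski *ᵥ w = 0) :
    ∃ E : Matrix (Fin 4) (Fin 4) ℝ, Eᵀ * minkowski * E = minkowski ∧ E.col 0 = u ∧ E.col 1 = w := by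
  -- The boost needs `u_0 ≥ 0`; otherwise `-E` is used, with `E` a frame for `(-u, -w)`.
  wlog h0 : 0 ≤ u 0 generalizing u w
  · obtain ⟨E, h1, h2, h3⟩ := this (-u) (-w) (by simpa [Matrix.mulVec_neg] using hu)
      (by simpa [Matrix.mulVec_neg] using hw) (by simpa [Matrix.mulVec_neg] using huw)
      (by simp only [Pi.neg_apply]; linarith)
    refine ⟨-E, by simpa using h1, ?_, ?_⟩
    · ext i
      simpa [neg_eq_iff_eq_neg] using congrFun h2 i
    · ext i
      simpa [neg_eq_iff_eq_neg] using congrFun h3 i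
  have hu' := hu
  rw [dotProduct_minkowski] at hu'
  obtain ⟨L, hL, hL0⟩ := exists_boost u (by linear_combination hu') h0
  have hLu := (isUnit_det_of_conj_eq_minkowski hL).1
  -- The boosted-back vector `L⁻¹ w` is spatial and has unit length.
  set n := L⁻¹ *ᵥ w with hn
  have hLn : L *ᵥ n = w := by
    rw [hn, Matrix.mulVec_mulVec, Matrix.mul_nonsing_inv _ hLu, Matrix.one_mulVec]
  have hLe : L *ᵥ (Pi.single 0 1) = u := by rw [Matrix.mulVec_single_one, ← hL0]
  have hn0 : n 0 = 0 := by
    have := dotProduct_conj L minkowski (Pi.single 0 1) n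
    rw [hL, hLn, hLe, huw, dotProduct_minkowski] at this
    simpa using this
  have hn1 : n 1 ^ 2 + n 2 ^ 2 + n 3 ^ 2 = 1 := by
    have := dotProduct_conj L minkowski n n
    rw [hL, hLn, hw, dotProduct_minkowski, hn0] at this
    linear_combination this
  obtain ⟨R, hR, hR0, hR1⟩ := exists_spatial_rotation n hn0 hn1
  refine ⟨L * R, ?_, ?_, ?_⟩
  · rw [Matrix.transpose_mul, show Rᵀ * Lᵀ * minkowski * (L * R) = Rᵀ * (Lᵀ * minkowski * L) * R by
      simp only [Matrix.mul_assoc], hL, hR]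
  · rw [← hLe, ← hR0]
    rfl
  · rw [← hLn, ← hR1]
    rfl

/-- At a point, a metric and a unitary 2-form have the components `minkowski` and
`unitaryNormal` in a suitable positively oriented basis. -/
def HasAdaptedFrame (G F : Matrix (Fin 4) (Fin 4) ℝ) : Prop :=
  ∃ E : Matrix (Fin 4) (Fin 4) ℝ, 0 < E.det ∧ Eᵀ * G * E = minkowski ∧ Eᵀ * F * E = unitaryNormal

theorem hasAdaptedFrame_of_plane {G F B : Matrix (Fin 4) (Fin 4) ℝ}
    (hB : Bᵀ * G * B = minkowski) (u w : Fin 4 → ℝ) (hu : u ⬝ᵥ G *ᵥ u = -1)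
    (hw : w ⬝ᵥ G *ᵥ w = 1) (huw : u ⬝ᵥ G *ᵥ w = 0)
    (hF : ∀ a b, F a b = (u ᵥ* G) a * (w ᵥ* G) b - (u ᵥ* G) b * (w ᵥ* G) a) :
    HasAdaptedFrame G F := by
  have hBu := (isUnit_det_of_conj_eq_minkowski hB).1
  have hBinv : ∀ v, B *ᵥ (B⁻¹ *ᵥ v) = v := fun v => by
    rw [Matrix.mulVec_mulVec, Matrix.mul_nonsing_inv _ hBu, Matrix.one_mulVec]
  have hconj : ∀ v v', (B⁻¹ *ᵥ v) ⬝ᵥ minkowski *ᵥ (B⁻¹ *ᵥ v') = v ⬝ᵥ G *ᵥ v' := fun v v' => by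
    rw [← hB, dotProduct_conj, hBinv, hBinv]
  obtain ⟨L, hL, hL0, hL1⟩ := exists_lorentz_frame (B⁻¹ *ᵥ u) (B⁻¹ *ᵥ w)
    (by rw [hconj, hu]) (by rw [hconj, hw]) (by rw [hconj, huw])
  have main : ∀ E : Matrix (Fin 4) (Fin 4) ℝ, Eᵀ * G * E = minkowski → E.col 0 = u →
      E.col 1 = w → Eᵀ * F * E = unitaryNormal := by
    intro E hE h0 h1
    have hF' : F = vecMulVec (u ᵥ* G) (w ᵥ* G) - vecMulVec (w ᵥ* G) (u ᵥ* G) := by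
      ext a b
      rw [hF, Matrix.sub_apply, vecMulVec_apply, vecMulVec_apply]
      ring
    have hrow : ∀ i, (E.col i ᵥ* G) ᵥ* E = minkowski i := by
      intro i
      ext j
      rw [← hE]
      rfl
    rw [hF', ← h0, ← h1, Matrix.mul_sub, Matrix.sub_mul, Matrix.mul_vecMulVec, Matrix.mul_vecMulVec,
      Matrix.vecMulVec_mul, Matrix.vecMulVec_mul, Matrix.mulVec_transpose, Matrix.mulVec_transpose,
      hrow, hrow]
    ext a b
    fin_cases a <;> fin_cases b <;> simp [vecMulVec_apply, minkowski, unitaryNormal]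
  have hE : (B * L)ᵀ * G * (B * L) = minkowski := by
    rw [Matrix.transpose_mul, show Lᵀ * Bᵀ * G * (B * L) = Lᵀ * (Bᵀ * G * B) * L by
      simp only [Matrix.mul_assoc], hB, hL]
  have hE0 : (B * L).col 0 = u := by
    rw [← hBinv u, ← hL0]
    rfl
  have hE1 : (B * L).col 1 = w := by
    rw [← hBinv w, ← hL1]
    rfl
  -- Reversing the last vector of the basis corrects the orientation.
  rcases lt_or_gt_of_ne (isUnit_det_of_conj_eq_minkowski hE).1.ne_zero with h | h
  · have hD : (Matrix.diagonal ![1, 1, 1, -1] : Matrix (Fin 4) (Fin 4) ℝ)ᵀ * minkowski *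
        Matrix.diagonal ![1, 1, 1, -1] = minkowski := by
      rw [minkowski, Matrix.diagonal_transpose, Matrix.diagonal_mul_diagonal,
        Matrix.diagonal_mul_diagonal]
      congr 1
      ext i
      fin_cases i <;> simp
    have hE' : (B * L * Matrix.diagonal ![1, 1, 1, -1])ᵀ * G *
        (B * L * Matrix.diagonal ![1, 1, 1, -1]) = minkowski := by
      rw [Matrix.transpose_mul (B * L), show (Matrix.diagonal ![1, 1, 1, -1])ᵀ * (B * L)ᵀ * G *
        (B * L * Matrix.diagonal ![1, 1, 1, -1]) = (Matrix.diagonal ![1, 1, 1, -1])ᵀ *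
          ((B * L)ᵀ * G * (B * L)) * Matrix.diagonal ![1, 1, 1, -1] by
        simp only [Matrix.mul_assoc], hE, hD]
    refine ⟨B * L * Matrix.diagonal ![1, 1, 1, -1], ?_, hE', main _ hE' ?_ ?_⟩
    · rw [det_mul, Matrix.det_diagonal]
      simpa [Fin.prod_univ_four] using h
    · rw [← hE0]
      ext i
      simp [Matrix.mul_diagonal]
    · rw [← hE1]
      ext i
      simp [Matrix.mul_diagonal]
  · exact ⟨B * L, h, hE, main _ hE hE0 hE1⟩

/-! ### Smoothness of the algebraic operations -/

section Smooth

variable {X : Type*} [NormedAddCommGroup X] [NormedSpace ℝ X] {x : X}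
  {G F : X → Matrix (Fin 4) (Fin 4) ℝ}

theorem contDiffAt_det (hG : ∀ a b, ContDiffAt ℝ ∞ (fun z => G z a b) x) :
    ContDiffAt ℝ ∞ (fun z => (G z).det) x := by
  simp only [Matrix.det_apply']
  exact ContDiffAt.sum fun σ _ => contDiffAt_const.mul (contDiffAt_prod fun i _ => hG _ _)

theorem contDiffAt_inv (hG : ∀ a b, ContDiffAt ℝ ∞ (fun z => G z a b) x)
    (hx : IsUnit (G x).det) (a b : Fin 4) : ContDiffAt ℝ ∞ (fun z => (G z)⁻¹ a b) x := by
  simp only [Matrix.inv_def, Matrix.smul_apply, Ring.inverse_eq_inv', smul_eq_mul,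
    Matrix.adjugate_apply]
  refine ((contDiffAt_det hG).inv hx.ne_zero).mul (contDiffAt_det fun i j => ?_)
  by_cases h : i = b
  · simp only [h, Matrix.updateRow_self]
    exact contDiffAt_const
  · simp only [ne_eq, h, not_false_eq_true, Matrix.updateRow_ne]
    exact hG i j

theorem contDiffAt_sqrt_det (hG : ∀ a b, ContDiffAt ℝ ∞ (fun z => G z a b) x)
    (hx : IsUnit (G x).det) : ContDiffAt ℝ ∞ (fun z => Real.sqrt |(G z).det|) x :=
  ContDiffAt.sqrt (ContDiffAt.comp (g := fun r : ℝ => |r|) x (contDiffAt_abs hx.ne_zero)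
    (contDiffAt_det hG)) (abs_ne_zero.mpr hx.ne_zero)

theorem contDiffAt_hodgeAt (hG : ∀ a b, ContDiffAt ℝ ∞ (fun z => G z a b) x)
    (hF : ∀ a b, ContDiffAt ℝ ∞ (fun z => F z a b) x)
    (hx : IsUnit (G x).det) (a b : Fin 4) :
    ContDiffAt ℝ ∞ (fun z => hodgeAt (G z) (F z) a b) x := by
  have hi := contDiffAt_inv hG hx
  have hs := contDiffAt_sqrt_det hG hx
  simp only [hodgeAt, hodge2, raise2, vol, Matrix.of_apply]
  exact contDiffAt_const.mul (ContDiffAt.sum fun c _ => ContDiffAt.sum fun d _ =>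
    (ContDiffAt.sum fun p _ => ContDiffAt.sum fun q _ => ((hi c p).mul (hi d q)).mul (hF p q)).mul
      (hs.mul contDiffAt_const))

end Smooth

/-! ### The invariant pairing of 2-forms -/

/-- The pairing `A_{ab} B^{ab}`. -/
noncomputable def pairing (G A B : Matrix (Fin 4) (Fin 4) ℝ) : ℝ :=
  ∑ a, ∑ b, A a b * raise2 (fun _ => G) (fun _ => B) 0 a b

theorem pairing_eq_trace (G A B : Matrix (Fin 4) (Fin 4) ℝ) :
    pairing G A B = (Aᵀ * (G⁻¹ * B * G⁻¹ᵀ)).trace := by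
  have h : ∀ a b, raise2 (fun _ => G) (fun _ => B) 0 a b = (G⁻¹ * B * G⁻¹ᵀ) a b := by
    intro a b
    simp only [raise2, Matrix.mul_apply, Matrix.transpose_apply, Finset.sum_mul]
    rw [Finset.sum_comm]
    refine Finset.sum_congr rfl fun p _ => Finset.sum_congr rfl fun q _ => ?_
    ring
  simp only [pairing, h, Matrix.trace, Matrix.diag_apply]
  rw [Finset.sum_comm]
  refine Finset.sum_congr rfl fun b _ => ?_
  rw [Matrix.mul_apply]
  rfl

theorem pairing_conj (P G A B : Matrix (Fin 4) (Fin 4) ℝ) (hP : IsUnit P.det) :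
    pairing (Pᵀ * G * P) (Pᵀ * A * P) (Pᵀ * B * P) = pairing G A B := by
  have hP' : IsUnit Pᵀ.det := by rwa [det_transpose]
  rw [pairing_eq_trace, pairing_eq_trace]
  have e : (Pᵀ * A * P)ᵀ * ((Pᵀ * G * P)⁻¹ * (Pᵀ * B * P) * (Pᵀ * G * P)⁻¹ᵀ) =
      Pᵀ * (Aᵀ * (G⁻¹ * B * G⁻¹ᵀ) * Pᵀ⁻¹) := by
    simp only [Matrix.mul_inv_rev, Matrix.transpose_mul, Matrix.transpose_nonsing_inv,
      Matrix.transpose_transpose, Matrix.mul_assoc]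
    rw [← Matrix.mul_assoc P P⁻¹, Matrix.mul_nonsing_inv _ hP, Matrix.one_mul,
      ← Matrix.mul_assoc Pᵀ⁻¹ Pᵀ, Matrix.nonsing_inv_mul _ hP', Matrix.one_mul,
      ← Matrix.mul_assoc P P⁻¹, Matrix.mul_nonsing_inv _ hP, Matrix.one_mul]
  rw [e, Matrix.trace_mul_comm, Matrix.mul_assoc, Matrix.nonsing_inv_mul _ hP', Matrix.mul_one]

theorem pairing_add_left (G A B C : Matrix (Fin 4) (Fin 4) ℝ) :
    pairing G (A + B) C = pairing G A C + pairing G B C := by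
  simp [pairing_eq_trace, Matrix.add_mul]

theorem pairing_add_right (G A B C : Matrix (Fin 4) (Fin 4) ℝ) :
    pairing G A (B + C) = pairing G A B + pairing G A C := by
  simp [pairing_eq_trace, Matrix.add_mul, Matrix.mul_add]

theorem pairing_smul_left (G A B : Matrix (Fin 4) (Fin 4) ℝ) (r : ℝ) :
    pairing G (r • A) B = r * pairing G A B := by
  simp [pairing_eq_trace]

theorem pairing_smul_right (G A B : Matrix (Fin 4) (Fin 4) ℝ) (r : ℝ) :
    pairing G A (r • B) = r * pairing G A B := by
  simp [pairing_eq_trace]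

/-! ### Covariant differentiation -/

/-- The connection matrix `(Γ_c)^d_a = Γ^d_{ca}`. -/
noncomputable def connMatrix (g : Tensor2) (y : Coord) (c : Fin 4) : Matrix (Fin 4) (Fin 4) ℝ :=
  Matrix.of fun d a => christoffel g y d c a

/-- The matrix of partial derivatives `∂_c F_{ab}`. -/
noncomputable def pdMatrix (F : Tensor2) (y : Coord) (c : Fin 4) : Matrix (Fin 4) (Fin 4) ℝ :=
  Matrix.of fun a b => pd (fun z => F z a b) c y

/-- The matrix of covariant derivatives `∇_c F_{ab}`. -/
noncomputable def covMatrix (g F : Tensor2) (y : Coord) (c : Fin 4) : Matrix (Fin 4) (Fin 4) ℝ :=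
  Matrix.of fun a b => cov g F y c a b

theorem pdMatrix_eq (g F : Tensor2) (y : Coord) (c : Fin 4) :
    pdMatrix F y c = (connMatrix g y c)ᵀ * F y + F y * connMatrix g y c + covMatrix g F y c := by
  ext a b
  simp only [pdMatrix, covMatrix, connMatrix, cov, Matrix.add_apply, Matrix.mul_apply,
    Matrix.of_apply, Matrix.transpose_apply]
  simp only [mul_comm (F y a _)]
  ring

theorem pd_congr {f h : Coord → ℝ} {y : Coord} (H : f =ᶠ[𝓝 y] h) (c : Fin 4) :
    pd f c y = pd h c y := by
  rw [pd, pd, H.fderiv_eq]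

theorem christoffel_symm {g : Tensor2} {y : Coord} (hs : ∀ᶠ z in 𝓝 y, (g z)ᵀ = g z)
    (k i j : Fin 4) : christoffel g y k i j = christoffel g y k j i := by
  have h := pd_congr (f := fun z => g z i j) (h := fun z => g z j i)
    (hs.mono fun z hz => congrFun (congrFun hz j) i)
  simp only [christoffel, h]
  congr 1
  refine Finset.sum_congr rfl fun l _ => ?_
  ring

/-- The Levi-Civita connection is metric. -/
theorem pdMatrix_metric {g : Tensor2} {y : Coord} (hs : ∀ᶠ z in 𝓝 y, (g z)ᵀ = g z)
    (hu : IsUnit (g y).det) (c : Fin 4) :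
    pdMatrix g y c = (connMatrix g y c)ᵀ * g y + g y * connMatrix g y c := by
  have hsymm : ∀ a b c, pd (fun z => g z a b) c y = pd (fun z => g z b a) c y := fun a b c =>
    pd_congr (hs.mono fun z hz => congrFun (congrFun hz b) a) c
  have hlow : ∀ m i j, (g y * connMatrix g y i) m j = (1 / 2) *
      (pd (fun z => g z j m) i y + pd (fun z => g z i m) j y - pd (fun z => g z i j) m y) := by
    intro m i j
    let r : Fin 4 → ℝ := fun l =>
      pd (fun z => g z j l) i y + pd (fun z => g z i l) j y - pd (fun z => g z i j) l y
    have h1 : ∀ k, connMatrix g y i k j = (1 / 2) * ((g y)⁻¹ *ᵥ r) k := fun k => rfl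
    have h2 : (g y *ᵥ ((g y)⁻¹ *ᵥ r)) m = r m := by
      rw [Matrix.mulVec_mulVec, Matrix.mul_nonsing_inv _ hu, Matrix.one_mulVec]
    rw [Matrix.mul_apply]
    simp only [h1]
    change _ = (1 / 2) * r m
    rw [← h2, Matrix.mulVec, dotProduct, Finset.mul_sum]
    refine Finset.sum_congr rfl fun k _ => ?_
    ring
  have hT : (connMatrix g y c)ᵀ * g y = (g y * connMatrix g y c)ᵀ := by
    rw [Matrix.transpose_mul, hs.self_of_nhds]
  rw [hT]
  ext a b
  rw [Matrix.add_apply, Matrix.transpose_apply, hlow, hlow, pdMatrix, Matrix.of_apply,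
    hsymm a b c, hsymm c b a, hsymm c a b, hsymm a c b]
  rw [hsymm b c a]
  ring

/-- The chain rule for a function of two matrices along a curve. -/
theorem hasDerivAt_comp_curve {h : Matrix (Fin 4) (Fin 4) ℝ → Matrix (Fin 4) (Fin 4) ℝ → ℝ}
    {L : (Fin 4 → Fin 4 → ℝ) × (Fin 4 → Fin 4 → ℝ) →L[ℝ] ℝ}
    {A B : ℝ → Matrix (Fin 4) (Fin 4) ℝ} {A' B' : Matrix (Fin 4) (Fin 4) ℝ}
    (hL : HasFDerivAt (fun p : (Fin 4 → Fin 4 → ℝ) × (Fin 4 → Fin 4 → ℝ) =>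
      h (Matrix.of p.1) (Matrix.of p.2)) L (Matrix.of.symm (A 0), Matrix.of.symm (B 0)))
    (hA : ∀ a b, HasDerivAt (fun t => A t a b) (A' a b) 0)
    (hB : ∀ a b, HasDerivAt (fun t => B t a b) (B' a b) 0) :
    HasDerivAt (fun t => h (A t) (B t)) (L (Matrix.of.symm A', Matrix.of.symm B')) 0 := by
  have hA' : HasDerivAt (fun t => Matrix.of.symm (A t)) (Matrix.of.symm A') 0 :=
    hasDerivAt_pi.mpr fun a => hasDerivAt_pi.mpr fun b => hA a b
  have hB' : HasDerivAt (fun t => Matrix.of.symm (B t)) (Matrix.of.symm B') 0 :=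
    hasDerivAt_pi.mpr fun a => hasDerivAt_pi.mpr fun b => hB a b
  exact hL.comp_hasDerivAt (0 : ℝ) (hA'.prodMk hB')

theorem hasDerivAt_conj (Γ M : Matrix (Fin 4) (Fin 4) ℝ) (a b : Fin 4) :
    HasDerivAt (fun t : ℝ => ((1 + t • Γ)ᵀ * M * (1 + t • Γ) : Matrix (Fin 4) (Fin 4) ℝ) a b)
      ((Γᵀ * M + M * Γ) a b) 0 := by
  have e : (fun t : ℝ => ((1 + t • Γ)ᵀ * M * (1 + t • Γ) : Matrix (Fin 4) (Fin 4) ℝ) a b) =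
    fun t : ℝ =>
      M a b + t * (Γᵀ * M + M * Γ) a b + t ^ 2 * (Γᵀ * M * Γ) a b := by
    funext t
    have : (1 + t • Γ)ᵀ * M * (1 + t • Γ) = M + t • (Γᵀ * M + M * Γ) + t ^ 2 • (Γᵀ * M * Γ) := by
      simp only [Matrix.transpose_add, Matrix.transpose_one, Matrix.transpose_smul,
        Matrix.add_mul, Matrix.mul_add, Matrix.one_mul, Matrix.mul_one, Matrix.smul_mul,
        Matrix.mul_smul, smul_add, smul_smul, pow_two]
      abel
    rw [this]
    simp only [Matrix.add_apply, Matrix.smul_apply, smul_eq_mul]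
  rw [e]
  have := (((hasDerivAt_id (0 : ℝ)).mul_const ((Γᵀ * M + M * Γ) a b)).const_add (M a b)).add
    (((hasDerivAt_id (0 : ℝ)).pow 2).mul_const ((Γᵀ * M * Γ) a b))
  convert! this using 1
  simp

theorem hasDerivAt_line_of_differentiableAt {f : Coord → ℝ} {y : Coord}
    (hf : DifferentiableAt ℝ f y) (c : Fin 4) :
    HasDerivAt (fun t : ℝ => f (y + t • coordVec c)) (pd f c y) 0 :=
  hf.hasFDerivAt.hasLineDerivAt (coordVec c)

/-- A function of a metric and a 2-tensor whose derivative along a change of basis is `d₁` and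
along the covariant derivative of the tensor is `d₂` has derivative `d₁ + d₂`: the partial
derivatives of a metric come from the infinitesimal change of basis given by the connection. -/
theorem pd_eq_add_of_hasDerivAt {g F : Tensor2} {y : Coord} {c : Fin 4}
    {h : Matrix (Fin 4) (Fin 4) ℝ → Matrix (Fin 4) (Fin 4) ℝ → ℝ} {d₁ d₂ : ℝ}
    (hs : ∀ᶠ z in 𝓝 y, (g z)ᵀ = g z) (hu : IsUnit (g y).det)
    (hh : DifferentiableAt ℝ (fun p : (Fin 4 → Fin 4 → ℝ) × (Fin 4 → Fin 4 → ℝ) =>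
      h (Matrix.of p.1) (Matrix.of p.2)) (Matrix.of.symm (g y), Matrix.of.symm (F y)))
    (hg : ∀ a b, DifferentiableAt ℝ (fun z => g z a b) y)
    (hF : ∀ a b, DifferentiableAt ℝ (fun z => F z a b) y)
    (h₁ : HasDerivAt (fun t : ℝ =>
      h ((1 + t • connMatrix g y c)ᵀ * g y * (1 + t • connMatrix g y c))
      ((1 + t • connMatrix g y c)ᵀ * F y * (1 + t • connMatrix g y c))) d₁ 0)
    (h₂ : HasDerivAt (fun t : ℝ => h (g y) (F y + t • covMatrix g F y c)) d₂ 0) :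
    pd (fun z => h (g z) (F z)) c y = d₁ + d₂ := by
  have hd : DifferentiableAt ℝ (fun z => h (g z) (F z)) y := by
    have hg' : DifferentiableAt ℝ (fun z => Matrix.of.symm (g z)) y :=
      differentiableAt_pi.mpr fun a => differentiableAt_pi.mpr fun b => hg a b
    have hF' : DifferentiableAt ℝ (fun z => Matrix.of.symm (F z)) y :=
      differentiableAt_pi.mpr fun a => differentiableAt_pi.mpr fun b => hF a b
    exact DifferentiableAt.comp y hh (hg'.prodMk hF')
  obtain ⟨L, hL⟩ := hh
  -- The three derivatives are values of the Fréchet derivative `L` of `h`.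
  have e₁ := h₁.unique (hasDerivAt_comp_curve (h := h) (L := L)
    (A := fun t => (1 + t • connMatrix g y c)ᵀ * g y * (1 + t • connMatrix g y c))
    (B := fun t => (1 + t • connMatrix g y c)ᵀ * F y * (1 + t • connMatrix g y c))
    (by simpa using hL) (hasDerivAt_conj _ _) (hasDerivAt_conj _ _))
  have e₂ := h₂.unique (hasDerivAt_comp_curve (h := h) (L := L)
    (A := fun _ => g y) (A' := 0) (B := fun t => F y + t • covMatrix g F y c)
    (B' := covMatrix g F y c) (by simpa using hL) (fun a b => hasDerivAt_const 0 _) (fun a b => by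
      simpa using ((hasDerivAt_id (0 : ℝ)).mul_const (covMatrix g F y c a b)).const_add (F y a b)))
  have e₃ := (hasDerivAt_line_of_differentiableAt hd c).unique (hasDerivAt_comp_curve
    (h := h) (L := L) (A := fun t => g (y + t • coordVec c)) (B := fun t => F (y + t • coordVec c))
    (A' := pdMatrix g y c) (B' := pdMatrix F y c) (by simpa using hL)
    (fun a b => hasDerivAt_line_of_differentiableAt (hg a b) c)
    (fun a b => hasDerivAt_line_of_differentiableAt (hF a b) c))
  rw [e₁, e₂, e₃, ← map_add, pdMatrix_metric hs hu, pdMatrix_eq g F]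
  congr 1
  ext a b
  · change _ = _ + (0 : ℝ)
    rw [add_zero]
  · rfl

/-! ### Metrics and unitary 2-forms in an adapted frame -/

theorem eq_conj_of_conj_eq {E A B : Matrix (Fin 4) (Fin 4) ℝ} (hE : IsUnit E.det)
    (h : Eᵀ * A * E = B) : A = (E⁻¹)ᵀ * B * E⁻¹ := by
  have hE' : IsUnit Eᵀ.det := by rwa [det_transpose]
  rw [← h, Matrix.transpose_nonsing_inv, Matrix.mul_assoc, Matrix.mul_assoc (Eᵀ * A),
    Matrix.mul_nonsing_inv _ hE, Matrix.mul_one, ← Matrix.mul_assoc, Matrix.nonsing_inv_mul _ hE',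
    Matrix.one_mul]

section Frame

variable {G F E : Matrix (Fin 4) (Fin 4) ℝ}

theorem HasAdaptedFrame.isUnit_det (h : HasAdaptedFrame G F) : IsUnit G.det := by
  obtain ⟨E, -, hG, -⟩ := h
  exact (isUnit_det_of_conj_eq_minkowski hG).2

theorem HasAdaptedFrame.transpose_metric (h : HasAdaptedFrame G F) : Gᵀ = G := by
  obtain ⟨E, h0, hG, -⟩ := h
  have := eq_conj_of_conj_eq h0.ne'.isUnit hG
  rw [this]
  simp only [Matrix.transpose_mul, Matrix.transpose_transpose, minkowski,
    Matrix.diagonal_transpose, Matrix.mul_assoc]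

theorem unitaryNormal_transpose : unitaryNormalᵀ = - unitaryNormal := by
  ext i j
  fin_cases i <;> fin_cases j <;> simp [unitaryNormal]

theorem HasAdaptedFrame.transpose_form (h : HasAdaptedFrame G F) : Fᵀ = -F := by
  obtain ⟨E, h0, -, hF⟩ := h
  have := eq_conj_of_conj_eq h0.ne'.isUnit hF
  rw [this]
  simp only [Matrix.transpose_mul, Matrix.transpose_transpose, unitaryNormal_transpose,
    Matrix.mul_assoc]
  simp

theorem skew_of_transpose (h : Fᵀ = -F) (a b : Fin 4) : F a b = - F b a := by
  have := congrFun (congrFun h b) a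
  simpa using this

theorem transpose_of_skew (h : ∀ a b, F a b = - F b a) : Fᵀ = -F := by
  ext a b
  simpa using h b a

theorem transpose_conj_of_skew (h : Fᵀ = -F) : (Eᵀ * F * E)ᵀ = -(Eᵀ * F * E) := by
  simp only [Matrix.transpose_mul, Matrix.transpose_transpose, h, Matrix.mul_assoc]
  simp

/-- In Lorentzian signature the Hodge dual of 2-forms squares to `-1`. -/
theorem hodgeAt_hodgeAt (hE : 0 < E.det) (hG : Eᵀ * G * E = minkowski) (hF : Fᵀ = -F) :
    hodgeAt G (hodgeAt G F) = -F := by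
  have h : ∀ F' : Matrix (Fin 4) (Fin 4) ℝ, F'ᵀ = -F' →
      hodgeAt minkowski (hodgeAt minkowski F') = -F' := by
    intro F' hF'
    have h1 := skew_of_transpose hF'
    rw [hodgeAt_minkowski _ (hodgeAt_skew _ _), hodgeAt_minkowski _ h1]
    have h10 := h1 1 0
    have h20 := h1 2 0
    have h30 := h1 3 0
    have h21 := h1 2 1
    have h31 := h1 3 1
    have h32 := h1 3 2
    have h00 := h1 0 0
    have h11 := h1 1 1
    have h22 := h1 2 2
    have h33 := h1 3 3
    ext a b
    fin_cases a <;> fin_cases b <;> simp <;> linarith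
  have h2 := h _ (transpose_conj_of_skew (E := E) hF)
  rw [← hG, hodgeAt_conj _ _ _ hE, hodgeAt_conj _ _ _ hE] at h2
  rw [eq_conj_of_conj_eq hE.ne'.isUnit h2]
  have h3 := eq_conj_of_conj_eq (E := E) hE.ne'.isUnit (rfl : Eᵀ * F * E = _)
  rw [Matrix.mul_neg, Matrix.neg_mul, ← h3]

theorem HasAdaptedFrame.hodgeAt_hodgeAt {H : Matrix (Fin 4) (Fin 4) ℝ} (h : HasAdaptedFrame G F)
    (hH : Hᵀ = -H) : hodgeAt G (hodgeAt G H) = -H := by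
  obtain ⟨E, h0, hG, -⟩ := h
  exact KillingYano.hodgeAt_hodgeAt h0 hG hH

/-- The dual of `unitaryNormal`: the volume element of the orthogonal plane. -/
def unitaryDual : Matrix (Fin 4) (Fin 4) ℝ := !![0, 0, 0, 0; 0, 0, 0, 0; 0, 0, 0, 1; 0, 0, -1, 0]

theorem hodgeAt_unitaryNormal : hodgeAt minkowski unitaryNormal = unitaryDual := by
  rw [hodgeAt_minkowski _ (skew_of_transpose unitaryNormal_transpose)]
  ext i j
  fin_cases i <;> fin_cases j <;> simp [unitaryNormal, unitaryDual]

theorem pairing_minkowski (A B : Matrix (Fin 4) (Fin 4) ℝ) :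
    pairing minkowski A B = ∑ a, ∑ b, A a b * ((![-1, 1, 1, 1] : Fin 4 → ℝ) a * B a b *
      (![-1, 1, 1, 1] : Fin 4 → ℝ) b) := by
  simp [pairing, raise2, minkowski_inv]
  simp [minkowski, Matrix.diagonal_apply]
  refine Finset.sum_congr rfl fun a _ => Finset.sum_congr rfl fun b _ => ?_
  ring

theorem HasAdaptedFrame.pairing_self (h : HasAdaptedFrame G F) : pairing G F F = -2 := by
  obtain ⟨E, h0, hG, hF⟩ := h
  rw [← pairing_conj E G F F h0.ne'.isUnit, hG, hF, pairing_minkowski]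
  simp [unitaryNormal, Fin.sum_univ_four]
  norm_num

theorem HasAdaptedFrame.pairing_dual (h : HasAdaptedFrame G F) : pairing G F (hodgeAt G F) = 0 := by
  obtain ⟨E, h0, hG, hF⟩ := h
  rw [← pairing_conj E G F _ h0.ne'.isUnit, ← hodgeAt_conj _ _ _ h0, hG, hF, hodgeAt_unitaryNormal,
    pairing_minkowski]
  simp [unitaryNormal, unitaryDual, Fin.sum_univ_four]

theorem HasAdaptedFrame.pairing_dual_self (h : HasAdaptedFrame G F) :
    pairing G (hodgeAt G F) F = 0 := by
  obtain ⟨E, h0, hG, hF⟩ := h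
  rw [← pairing_conj E G _ F h0.ne'.isUnit, ← hodgeAt_conj _ _ _ h0, hG, hF, hodgeAt_unitaryNormal,
    pairing_minkowski]
  simp [unitaryNormal, unitaryDual, Fin.sum_univ_four]

theorem HasAdaptedFrame.pairing_dual_dual (h : HasAdaptedFrame G F) :
    pairing G (hodgeAt G F) (hodgeAt G F) = 2 := by
  obtain ⟨E, h0, hG, hF⟩ := h
  rw [← pairing_conj E G _ _ h0.ne'.isUnit, ← hodgeAt_conj _ _ _ h0, hG, hF, hodgeAt_unitaryNormal,
    pairing_minkowski]
  simp [unitaryDual, Fin.sum_univ_four]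
  norm_num

end Frame

/-! ### The covariant derivative of a unitary 2-form -/

/-- The coordinate expression of a metric and a unitary 2-form on an open set. -/
structure IsUnitaryPairOn (g U : Tensor2) (O : Set Coord) : Prop where
  isOpen : IsOpen O
  smooth_metric : ∀ a b, ContDiffOn ℝ ∞ (fun y => g y a b) O
  smooth_form : ∀ a b, ContDiffOn ℝ ∞ (fun y => U y a b) O
  frame : ∀ y ∈ O, HasAdaptedFrame (g y) (U y)

namespace IsUnitaryPairOn

variable {g U : Tensor2} {O : Set Coord} {y : Coord}

theorem metric (h : IsUnitaryPairOn g U O) (hy : y ∈ O) (a b : Fin 4) :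
    ContDiffAt ℝ ∞ (fun y => g y a b) y :=
  (h.smooth_metric a b).contDiffAt (h.isOpen.mem_nhds hy)

theorem form (h : IsUnitaryPairOn g U O) (hy : y ∈ O) (a b : Fin 4) :
    ContDiffAt ℝ ∞ (fun y => U y a b) y :=
  (h.smooth_form a b).contDiffAt (h.isOpen.mem_nhds hy)

theorem eventually_symm (h : IsUnitaryPairOn g U O) (hy : y ∈ O) : ∀ᶠ z in 𝓝 y, (g z)ᵀ = g z :=
  Filter.mem_of_superset (h.isOpen.mem_nhds hy) fun z hz => (h.frame z hz).transpose_metric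

theorem dual (h : IsUnitaryPairOn g U O) (hy : y ∈ O) (a b : Fin 4) :
    ContDiffAt ℝ ∞ (fun y => hodge2 g U y a b) y :=
  contDiffAt_hodgeAt (h.metric hy) (h.form hy) (h.frame y hy).isUnit_det a b

end IsUnitaryPairOn

theorem eventually_det_pos (Γ : Matrix (Fin 4) (Fin 4) ℝ) :
    ∀ᶠ t : ℝ in 𝓝 0, 0 < (1 + t • Γ).det := by
  have hc : Continuous fun t : ℝ => (1 + t • Γ).det :=
    (continuous_const.add (continuous_id.smul continuous_const)).matrix_det
  exact hc.continuousAt.eventually (lt_mem_nhds (by simp))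

theorem contDiffAt_joint_hodgeAt {G F : Matrix (Fin 4) (Fin 4) ℝ} (hu : IsUnit G.det)
    (a b : Fin 4) : ContDiffAt ℝ ∞ (fun p : (Fin 4 → Fin 4 → ℝ) × (Fin 4 → Fin 4 → ℝ) =>
      hodgeAt (Matrix.of p.1) (Matrix.of p.2) a b) (Matrix.of.symm G, Matrix.of.symm F) := by
  refine contDiffAt_hodgeAt (fun a b => ?_) (fun a b => ?_) hu a b
  · simp only [Matrix.of_apply]
    fun_prop
  · simp only [Matrix.of_apply]
    fun_prop

/-- The volume element is parallel: covariant differentiation commutes with the Hodge dual. -/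
theorem covMatrix_hodge {g F : Tensor2} {y : Coord} (hs : ∀ᶠ z in 𝓝 y, (g z)ᵀ = g z)
    (hu : IsUnit (g y).det) (hg : ∀ a b, DifferentiableAt ℝ (fun z => g z a b) y)
    (hF : ∀ a b, DifferentiableAt ℝ (fun z => F z a b) y) (c : Fin 4) :
    covMatrix g (hodge2 g F) y c = hodgeAt (g y) (covMatrix g F y c) := by
  ext a b
  have h := pd_eq_add_of_hasDerivAt (c := c) (h := fun G F => hodgeAt G F a b)
    (d₁ := ((connMatrix g y c)ᵀ * hodgeAt (g y) (F y) +
      hodgeAt (g y) (F y) * connMatrix g y c) a b)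
    (d₂ := hodgeAt (g y) (covMatrix g F y c) a b) hs hu
    ((contDiffAt_joint_hodgeAt hu a b).differentiableAt (by simp)) hg hF ?_ ?_
  · have h2 := congrFun (congrFun (pdMatrix_eq g (hodge2 g F) y c) a) b
    rw [pdMatrix, Matrix.of_apply] at h2
    simp only [hodge2_apply] at h2
    rw [h, Matrix.add_apply _ (covMatrix g _ y c)] at h2
    exact (add_left_cancel h2).symm
  · refine (hasDerivAt_conj (connMatrix g y c) (hodgeAt (g y) (F y)) a b).congr_of_eventuallyEq ?_
    filter_upwards [eventually_det_pos (connMatrix g y c)] with t ht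
    rw [hodgeAt_conj _ _ _ ht]
  · simp only [hodgeAt_add, hodgeAt_smul, Matrix.add_apply, Matrix.smul_apply, smul_eq_mul]
    simpa using ((hasDerivAt_id (0 : ℝ)).mul_const
      (hodgeAt (g y) (covMatrix g F y c) a b)).const_add (hodgeAt (g y) (F y) a b)

theorem contDiffAt_pairing {X : Type*} [NormedAddCommGroup X] [NormedSpace ℝ X] {x : X}
    {G A B : X → Matrix (Fin 4) (Fin 4) ℝ} (hG : ∀ a b, ContDiffAt ℝ ∞ (fun z => G z a b) x)
    (hA : ∀ a b, ContDiffAt ℝ ∞ (fun z => A z a b) x)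
    (hB : ∀ a b, ContDiffAt ℝ ∞ (fun z => B z a b) x) (hx : IsUnit (G x).det) :
    ContDiffAt ℝ ∞ (fun z => pairing (G z) (A z) (B z)) x := by
  have hi := contDiffAt_inv hG hx
  simp only [pairing, raise2]
  exact ContDiffAt.sum fun a _ => ContDiffAt.sum fun b _ => (hA a b).mul
    (ContDiffAt.sum fun p _ => ContDiffAt.sum fun q _ => ((hi a p).mul (hi b q)).mul (hB p q))

theorem hasDerivAt_quadratic (r s u : ℝ) :
    HasDerivAt (fun t : ℝ => r + t * s + t ^ 2 * u) s 0 := by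
  have := (((hasDerivAt_id (0 : ℝ)).mul_const s).const_add r).add
    (((hasDerivAt_id (0 : ℝ)).pow 2).mul_const u)
  convert! this using 1
  simp

namespace IsUnitaryPairOn

variable {g U : Tensor2} {O : Set Coord} {y : Coord}

theorem covMatrix_dual (h : IsUnitaryPairOn g U O) (hy : y ∈ O) (c : Fin 4) :
    covMatrix g (hodge2 g U) y c = hodgeAt (g y) (covMatrix g U y c) :=
  covMatrix_hodge (h.eventually_symm hy) (h.frame y hy).isUnit_det
    (fun a b => (h.metric hy a b).differentiableAt (by simp))
    (fun a b => (h.form hy a b).differentiableAt (by simp)) c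

theorem pd_eq_zero_of_const (h : IsUnitaryPairOn g U O) (hy : y ∈ O) {f : Coord → ℝ} {r : ℝ}
    (hf : ∀ z ∈ O, f z = r) (c : Fin 4) : pd f c y = 0 := by
  have : f =ᶠ[𝓝 y] fun _ => r := Filter.mem_of_superset (h.isOpen.mem_nhds hy) hf
  rw [pd_congr this]
  simp [pd]

/-- `∇U` is orthogonal to `U`, because `U_{ab} U^{ab}` is constant. -/
theorem pairing_cov_form (h : IsUnitaryPairOn g U O) (hy : y ∈ O) (c : Fin 4) :
    pairing (g y) (U y) (covMatrix g U y c) + pairing (g y) (covMatrix g U y c) (U y) = 0 := by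
  have hu := (h.frame y hy).isUnit_det
  have h0 := h.pd_eq_zero_of_const hy (fun z hz => (h.frame z hz).pairing_self) c
  rw [pd_eq_add_of_hasDerivAt (d₁ := 0) (h := fun G F => pairing G F F)
    (d₂ := pairing (g y) (U y) (covMatrix g U y c) + pairing (g y) (covMatrix g U y c) (U y))
    (h.eventually_symm hy) hu ?_ (fun a b => (h.metric hy a b).differentiableAt (by simp))
    (fun a b => (h.form hy a b).differentiableAt (by simp)) ?_ ?_, zero_add] at h0
  · exact h0
  · refine (contDiffAt_pairing (X := (Fin 4 → Fin 4 → ℝ) × (Fin 4 → Fin 4 → ℝ))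
      (x := (Matrix.of.symm (g y), Matrix.of.symm (U y))) (G := fun p => Matrix.of p.1)
      (A := fun p => Matrix.of p.2) (B := fun p => Matrix.of p.2) (fun a b => ?_) (fun a b => ?_)
      (fun a b => ?_) hu).differentiableAt (by simp) <;> simp only [Matrix.of_apply] <;> fun_prop
  · refine (hasDerivAt_const (0 : ℝ) (pairing (g y) (U y) (U y))).congr_of_eventuallyEq ?_
    filter_upwards [eventually_det_pos (connMatrix g y c)] with t ht
    rw [pairing_conj _ _ _ _ ht.ne'.isUnit]
  · convert! hasDerivAt_quadratic (pairing (g y) (U y) (U y)) _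
      (pairing (g y) (covMatrix g U y c) (covMatrix g U y c)) using 2 with t
    simp only [pairing_add_left, pairing_add_right, pairing_smul_left, pairing_smul_right]
    ring

/-- `∇U` is orthogonal to `*U`, because `U_{ab} (*U)^{ab}` is constant. -/
theorem pairing_cov_dual (h : IsUnitaryPairOn g U O) (hy : y ∈ O) (c : Fin 4) :
    pairing (g y) (U y) (hodgeAt (g y) (covMatrix g U y c)) +
      pairing (g y) (covMatrix g U y c) (hodgeAt (g y) (U y)) = 0 := by
  have hu := (h.frame y hy).isUnit_det
  have h0 := h.pd_eq_zero_of_const hy (fun z hz => (h.frame z hz).pairing_dual) c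
  rw [pd_eq_add_of_hasDerivAt (d₁ := 0) (h := fun G F => pairing G F (hodgeAt G F))
    (d₂ := pairing (g y) (U y) (hodgeAt (g y) (covMatrix g U y c)) +
      pairing (g y) (covMatrix g U y c) (hodgeAt (g y) (U y)))
    (h.eventually_symm hy) hu ?_ (fun a b => (h.metric hy a b).differentiableAt (by simp))
    (fun a b => (h.form hy a b).differentiableAt (by simp)) ?_ ?_, zero_add] at h0
  · exact h0
  · refine (contDiffAt_pairing (fun a b => ?_) (fun a b => ?_)
      (fun a b => contDiffAt_joint_hodgeAt hu a b) hu).differentiableAt (by simp) <;>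
      simp only [Matrix.of_apply] <;> fun_prop
  · refine (hasDerivAt_const (0 : ℝ)
      (pairing (g y) (U y) (hodgeAt (g y) (U y)))).congr_of_eventuallyEq ?_
    filter_upwards [eventually_det_pos (connMatrix g y c)] with t ht
    rw [hodgeAt_conj _ _ _ ht, pairing_conj _ _ _ _ ht.ne'.isUnit]
  · convert! hasDerivAt_quadratic (pairing (g y) (U y) (hodgeAt (g y) (U y))) _
      (pairing (g y) (covMatrix g U y c) (hodgeAt (g y) (covMatrix g U y c))) using 2 with t
    simp only [pairing_add_left, pairing_add_right, pairing_smul_left, pairing_smul_right,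
      hodgeAt_add, hodgeAt_smul]
    ring

end IsUnitaryPairOn

/-! ### The codifferential as a divergence -/

/-- The negative divergence `-T^a_{ad}` of a tensor given by the matrices `T_c`. -/
noncomputable def negDiv (G : Matrix (Fin 4) (Fin 4) ℝ) (T : Fin 4 → Matrix (Fin 4) (Fin 4) ℝ) :
    Fin 4 → ℝ := fun d => - ∑ a, ∑ p, G⁻¹ a p * T p a d

theorem negDiv_zero (G : Matrix (Fin 4) (Fin 4) ℝ) {T : Fin 4 → Matrix (Fin 4) (Fin 4) ℝ}
    (hT : ∀ c, T c = 0) (d : Fin 4) : negDiv G T d = 0 := by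
  simp [negDiv, hT]

/-- The connection is torsion-free: the exterior derivative is an alternation of `∇F`. -/
theorem extDeriv2_eq {g F : Tensor2} {y : Coord} (hs : ∀ᶠ z in 𝓝 y, (g z)ᵀ = g z)
    (hF : ∀ a b, F y a b = - F y b a) (a b c : Fin 4) :
    extDeriv2 F y a b c =
      covMatrix g F y a b c + covMatrix g F y b c a + covMatrix g F y c a b := by
  have h1 : ∀ i j k, ∑ d, christoffel g y d i j * F y d k =
      - ∑ d, christoffel g y d j i * F y k d := by
    intro i j k
    rw [← Finset.sum_neg_distrib]
    refine Finset.sum_congr rfl fun d _ => ?_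
    rw [christoffel_symm hs d i j, hF d k]
    ring
  simp only [covMatrix, Matrix.of_apply, cov, extDeriv2, h1]
  ring

/-- Raising the three indices of a tensor commutes with a cyclic permutation of them. -/
theorem raise3_cyclic (H : Matrix (Fin 4) (Fin 4) ℝ) (S : Fin 4 → Fin 4 → Fin 4 → ℝ)
    (a b c : Fin 4) :
    ∑ p, ∑ q, ∑ r, H a p * H b q * H c r * S q r p =
      ∑ p, ∑ q, ∑ r, H b p * H c q * H a r * S p q r := by
  rw [Finset.sum_comm]
  refine Finset.sum_congr rfl fun p _ => ?_
  rw [Finset.sum_comm]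
  refine Finset.sum_congr rfl fun q _ => Finset.sum_congr rfl fun r _ => ?_
  ring

theorem sum_three_cyclic (f : Fin 4 → Fin 4 → Fin 4 → ℝ) :
    ∑ a, ∑ b, ∑ c, f b c a = ∑ a, ∑ b, ∑ c, f a b c := by
  rw [Finset.sum_comm]
  refine Finset.sum_congr rfl fun a _ => ?_
  rw [Finset.sum_comm]

/-- The dual of the alternation of `S_{abc}` is the trace of the dual of `S` in its last two
indices. -/
theorem hodge3_cyclic_sum (g : Tensor2) (y : Coord) (S : Fin 4 → Matrix (Fin 4) (Fin 4) ℝ)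
    (β : Coord → Fin 4 → Fin 4 → Fin 4 → ℝ)
    (hβ : ∀ a b c, β y a b c = S a b c + S b c a + S c a b) (d : Fin 4) :
    hodge3 g β y d = ∑ a, ∑ p, (g y)⁻¹ a p * hodgeAt (g y) (S p) a d := by
  set H := (g y)⁻¹ with hH
  let B : Fin 4 → Fin 4 → Fin 4 → ℝ := fun a b c => ∑ p, ∑ q, ∑ r, H a p * H b q * H c r * S p q r
  have hvol : ∀ a b c, vol g y a b c d = vol g y b c a d := by
    intro a b c
    simp only [vol, leviCivita_eq]
    ring
  have h1 : ∀ a b c, ∑ p, ∑ q, ∑ r, H a p * H b q * H c r * β y p q r =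
      B a b c + B b c a + B c a b := by
    intro a b c
    have e1 := raise3_cyclic H (fun p q r => S p q r) a b c
    have e2 := raise3_cyclic H (fun p q r => S q r p) a b c
    have e3 := raise3_cyclic H (fun p q r => S p q r) b c a
    simp only [hβ, mul_add, Finset.sum_add_distrib]
    simp only [B]
    rw [e1, ← e3, ← e2]
  have h2 : ∀ a, ∑ p, H a p * hodgeAt (g y) (S p) a d =
      (1 / 2) * ∑ b, ∑ c, B a b c * vol g y b c a d := by
    intro a
    simp only [hodgeAt, hodge2, raise2, Matrix.of_apply, ← hH, Finset.mul_sum, Finset.sum_mul, B]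
    rw [Finset.sum_comm]
    refine Finset.sum_congr rfl fun b _ => ?_
    rw [Finset.sum_comm]
    refine Finset.sum_congr rfl fun c _ => Finset.sum_congr rfl fun p _ =>
      Finset.sum_congr rfl fun q _ => Finset.sum_congr rfl fun r _ => ?_
    simp only [vol]
    ring
  have h3 := sum_three_cyclic fun a b c => B a b c * vol g y a b c d
  have h4 := sum_three_cyclic fun a b c => B b c a * vol g y b c a d
  simp only [hodge3, ← hH, h1, h2, add_mul, Finset.sum_add_distrib]
  have e1 : ∑ a, ∑ b, ∑ c, B b c a * vol g y a b c d =
      ∑ a, ∑ b, ∑ c, B a b c * vol g y a b c d := by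
    rw [← h3]
    refine Finset.sum_congr rfl fun a _ => Finset.sum_congr rfl fun b _ =>
      Finset.sum_congr rfl fun c _ => ?_
    rw [hvol a b c]
  have e2 : ∑ a, ∑ b, ∑ c, B c a b * vol g y a b c d =
      ∑ a, ∑ b, ∑ c, B a b c * vol g y a b c d := by
    rw [← h3, ← h4]
    refine Finset.sum_congr rfl fun a _ => Finset.sum_congr rfl fun b _ =>
      Finset.sum_congr rfl fun c _ => ?_
    rw [hvol a b c, hvol b c a]
  have e3 : ∑ a, ∑ b, ∑ c, B a b c * vol g y b c a d =
      ∑ a, ∑ b, ∑ c, B a b c * vol g y a b c d := by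
    refine Finset.sum_congr rfl fun a _ => Finset.sum_congr rfl fun b _ =>
      Finset.sum_congr rfl fun c _ => ?_
    rw [hvol a b c]
  rw [e1, e2, ← Finset.mul_sum, e3]
  ring

theorem covMatrix_skew {g F : Tensor2} {y : Coord} (hF : ∀ᶠ z in 𝓝 y, (F z)ᵀ = -F z) (c : Fin 4) :
    (covMatrix g F y c)ᵀ = - covMatrix g F y c := by
  have hT : (pdMatrix F y c)ᵀ = - pdMatrix F y c := by
    ext a b
    have h : pd (fun z => F z b a) c y = pd (fun z => - F z a b) c y :=
      pd_congr (hF.mono fun z hz => congrFun (congrFun hz a) b) c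
    change pd (fun z => F z b a) c y = - pd (fun z => F z a b) c y
    rw [h, pd, pd, fderiv_fun_neg]
    rfl
  have h := pdMatrix_eq g F y c
  have h' : covMatrix g F y c = pdMatrix F y c -
      ((connMatrix g y c)ᵀ * F y + F y * connMatrix g y c) := by
    rw [h]; abel
  rw [h']
  simp only [Matrix.transpose_sub, Matrix.transpose_add, Matrix.transpose_mul,
    Matrix.transpose_transpose, hF.self_of_nhds, hT, Matrix.mul_neg, Matrix.neg_mul]
  abel

/-- `δ = *d*` is the negative divergence: `(δF)_b = -∇^a F_{ab}`. -/
theorem codiff_eq_negDiv {g F : Tensor2} {y : Coord} {F₀ : Matrix (Fin 4) (Fin 4) ℝ}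
    (hs : ∀ᶠ z in 𝓝 y, (g z)ᵀ = g z) (hfr : HasAdaptedFrame (g y) F₀)
    (hg : ∀ a b, DifferentiableAt ℝ (fun z => g z a b) y)
    (hF : ∀ a b, DifferentiableAt ℝ (fun z => F z a b) y)
    (hskew : ∀ᶠ z in 𝓝 y, (F z)ᵀ = -F z) :
    codiff g F y = negDiv (g y) (covMatrix g F y) := by
  funext d
  rw [codiff, hodge3_cyclic_sum g y (covMatrix g (hodge2 g F) y) _
    (extDeriv2_eq hs (hodgeAt_skew _ _)), negDiv, ← Finset.sum_neg_distrib]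
  refine Finset.sum_congr rfl fun a _ => ?_
  rw [← Finset.sum_neg_distrib]
  refine Finset.sum_congr rfl fun p _ => ?_
  rw [covMatrix_hodge hs hfr.isUnit_det hg hF, hfr.hodgeAt_hodgeAt (covMatrix_skew hskew p)]
  simp

namespace IsUnitaryPairOn

variable {g U : Tensor2} {O : Set Coord} {y : Coord}

theorem cov_skew (h : IsUnitaryPairOn g U O) (hy : y ∈ O) (c : Fin 4) :
    (covMatrix g U y c)ᵀ = - covMatrix g U y c :=
  covMatrix_skew (Filter.mem_of_superset (h.isOpen.mem_nhds hy)
    fun z hz => (h.frame z hz).transpose_form) c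

theorem codiff_form (h : IsUnitaryPairOn g U O) (hy : y ∈ O) :
    codiff g U y = negDiv (g y) (covMatrix g U y) :=
  codiff_eq_negDiv (h.eventually_symm hy) (h.frame y hy)
    (fun a b => (h.metric hy a b).differentiableAt (by simp))
    (fun a b => (h.form hy a b).differentiableAt (by simp))
    (Filter.mem_of_superset (h.isOpen.mem_nhds hy) fun z hz => (h.frame z hz).transpose_form)

theorem codiff_dual (h : IsUnitaryPairOn g U O) (hy : y ∈ O) :
    codiff g (hodge2 g U) y = negDiv (g y) fun c => hodgeAt (g y) (covMatrix g U y c) := by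
  rw [codiff_eq_negDiv (h.eventually_symm hy) (h.frame y hy)
    (fun a b => (h.metric hy a b).differentiableAt (by simp))
    (fun a b => (h.dual hy a b).differentiableAt (by simp))
    (Filter.Eventually.of_forall fun z => transpose_of_skew (hodgeAt_skew _ _))]
  congr 1
  funext c
  exact h.covMatrix_dual hy c

end IsUnitaryPairOn

/-! ### Pointwise algebra of the first derivatives -/

/-- The interior product `α^a M_{ab}` at a point. -/
noncomputable def interiorAt (G : Matrix (Fin 4) (Fin 4) ℝ) (α : Fin 4 → ℝ)
    (M : Matrix (Fin 4) (Fin 4) ℝ) : Fin 4 → ℝ := (G⁻¹ *ᵥ α) ᵥ* M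

/-- The value of `Φ[U]` at a point, for `∇U = T`. -/
noncomputable def phiAt (G U : Matrix (Fin 4) (Fin 4) ℝ) (T : Fin 4 → Matrix (Fin 4) (Fin 4) ℝ) :
    Fin 4 → ℝ :=
  interiorAt G (negDiv G T) U - interiorAt G (negDiv G fun c => hodgeAt G (T c)) (hodgeAt G U)

/-- The value of `Ψ[U]` at a point, for `∇U = T`. -/
noncomputable def psiAt (G U : Matrix (Fin 4) (Fin 4) ℝ) (T : Fin 4 → Matrix (Fin 4) (Fin 4) ℝ) :
    Fin 4 → ℝ :=
  - interiorAt G (negDiv G T) (hodgeAt G U) - interiorAt G (negDiv G fun c => hodgeAt G (T c)) U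

/-- The tensor `α^d G_{dcab} = α_a g_{cb} - α_b g_{ca}`. -/
def wedgeMetric (G : Matrix (Fin 4) (Fin 4) ℝ) (α : Fin 4 → ℝ) (c : Fin 4) :
    Matrix (Fin 4) (Fin 4) ℝ := vecMulVec α (G c) - vecMulVec (G c) α

/-- `√2` times the real part of `Σ[U]` at a point, for `∇U = T`. Its dual in the last two indices is
`-√2` times the imaginary part. -/
noncomputable def umbilicAt (G U : Matrix (Fin 4) (Fin 4) ℝ)
    (T : Fin 4 → Matrix (Fin 4) (Fin 4) ℝ) (c : Fin 4) : Matrix (Fin 4) (Fin 4) ℝ :=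
  T c - (1 / 2 : ℝ) • (phiAt G U T c • U + psiAt G U T c • hodgeAt G U)
    - (1 / 2 : ℝ) • (wedgeMetric G (negDiv G T) c
      - hodgeAt G (wedgeMetric G (negDiv G fun c => hodgeAt G (T c)) c))

/-- `e^{-φ} ∇A` at a point for `A = e^φ (cos ψ U + sin ψ *U)`, where `∇U = T`, `dφ = a`, `dψ = b`,
and `C = cos ψ`, `s = sin ψ`. -/
noncomputable def covCanonicalAt (G U : Matrix (Fin 4) (Fin 4) ℝ)
    (T : Fin 4 → Matrix (Fin 4) (Fin 4) ℝ) (C s : ℝ) (a b : Fin 4 → ℝ) (c : Fin 4) :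
    Matrix (Fin 4) (Fin 4) ℝ :=
  C • (a c • U + b c • hodgeAt G U + T c) + s • (a c • hodgeAt G U - b c • U + hodgeAt G (T c))

/-- The part of `T_{cab}` symmetric in its first two indices vanishes. -/
def IsKillingAt (T : Fin 4 → Matrix (Fin 4) (Fin 4) ℝ) : Prop := ∀ c a b, T c a b + T a c b = 0

/-- The components of a tensor `T_{cab}` in the basis given by the columns of `E`. -/
def changeBasis (E : Matrix (Fin 4) (Fin 4) ℝ) (T : Fin 4 → Matrix (Fin 4) (Fin 4) ℝ) (k : Fin 4) :
    Matrix (Fin 4) (Fin 4) ℝ := ∑ c, E c k • (Eᵀ * T c * E)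

section ChangeBasis

variable {E G : Matrix (Fin 4) (Fin 4) ℝ} {T : Fin 4 → Matrix (Fin 4) (Fin 4) ℝ}

theorem changeBasis_changeBasis (E E' : Matrix (Fin 4) (Fin 4) ℝ)
    (T : Fin 4 → Matrix (Fin 4) (Fin 4) ℝ) :
    changeBasis E' (changeBasis E T) = changeBasis (E * E') T := by
  funext k
  simp only [changeBasis, Matrix.mul_sum, Matrix.sum_mul, Finset.smul_sum, Matrix.mul_apply,
    Finset.sum_smul]
  rw [Finset.sum_comm]
  refine Finset.sum_congr rfl fun c _ => Finset.sum_congr rfl fun j _ => ?_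
  rw [Matrix.mul_smul, Matrix.smul_mul, smul_smul, Matrix.transpose_mul, mul_comm (E' j k)]
  simp only [Matrix.mul_assoc]

theorem changeBasis_one (T : Fin 4 → Matrix (Fin 4) (Fin 4) ℝ) : changeBasis 1 T = T := by
  funext k
  simp [changeBasis, Matrix.one_apply]

theorem eq_zero_of_changeBasis (hE : IsUnit E.det) (h : changeBasis E T = 0) : T = 0 := by
  have h1 := changeBasis_changeBasis E E⁻¹ T
  rw [Matrix.mul_nonsing_inv _ hE, changeBasis_one, h] at h1
  rw [← h1]
  funext k
  simp [changeBasis]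

theorem isKillingAt_changeBasis (h : IsKillingAt T) : IsKillingAt (changeBasis E T) := by
  have e : ∀ k i j, changeBasis E T k i j = ∑ b, ∑ c, ∑ a, E c k * E a i * T c a b * E b j := by
    intro k i j
    simp only [changeBasis, Matrix.sum_apply, Matrix.smul_apply, Matrix.mul_apply,
      Matrix.transpose_apply, smul_eq_mul, Finset.mul_sum, Finset.sum_mul]
    rw [Finset.sum_comm]
    refine Finset.sum_congr rfl fun b _ => Finset.sum_congr rfl fun c _ =>
      Finset.sum_congr rfl fun a _ => ?_
    ring
  intro k i j
  rw [e, e, ← Finset.sum_add_distrib]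
  refine Finset.sum_eq_zero fun b _ => ?_
  rw [Finset.sum_comm, ← Finset.sum_add_distrib]
  refine Finset.sum_eq_zero fun c _ => ?_
  rw [← Finset.sum_add_distrib]
  refine Finset.sum_eq_zero fun a _ => ?_
  linear_combination E a k * E c i * E b j * h a c b

theorem changeBasis_add (S : Fin 4 → Matrix (Fin 4) (Fin 4) ℝ) :
    changeBasis E (T + S) = changeBasis E T + changeBasis E S := by
  funext k
  simp [changeBasis, Matrix.mul_add, Matrix.add_mul, Finset.sum_add_distrib]

theorem changeBasis_smul (r : ℝ) : changeBasis E (r • T) = r • changeBasis E T := by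
  funext k
  simp [changeBasis, Finset.smul_sum, smul_comm r]

theorem changeBasis_sub (S : Fin 4 → Matrix (Fin 4) (Fin 4) ℝ) :
    changeBasis E (T - S) = changeBasis E T - changeBasis E S := by
  rw [sub_eq_add_neg, ← neg_one_smul ℝ S, changeBasis_add, changeBasis_smul, neg_one_smul,
    ← sub_eq_add_neg]

theorem changeBasis_tensor (α : Fin 4 → ℝ) (M : Matrix (Fin 4) (Fin 4) ℝ) :
    changeBasis E (fun c => α c • M) = fun k => (α ᵥ* E) k • (Eᵀ * M * E) := by
  funext k
  simp only [changeBasis, Matrix.mul_smul, Matrix.smul_mul, smul_smul, ← Finset.sum_smul,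
    Matrix.vecMul, dotProduct]
  simp only [mul_comm (E _ k)]

theorem hodgeAt_sum {ι : Type*} (s : Finset ι) (f : ι → Matrix (Fin 4) (Fin 4) ℝ) :
    hodgeAt G (∑ i ∈ s, f i) = ∑ i ∈ s, hodgeAt G (f i) :=
  map_sum (AddMonoidHom.mk' (hodgeAt G) (hodgeAt_add G)) f s

theorem changeBasis_hodgeAt (hE : 0 < E.det) :
    (fun k => hodgeAt (Eᵀ * G * E) (changeBasis E T k)) =
      changeBasis E fun c => hodgeAt G (T c) := by
  funext k
  simp only [changeBasis, hodgeAt_sum, hodgeAt_smul, hodgeAt_conj _ _ _ hE]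

theorem mul_inv_conj (hE : IsUnit E.det) : E * (Eᵀ * G * E)⁻¹ * Eᵀ = G⁻¹ := by
  have hE' : IsUnit Eᵀ.det := by rwa [det_transpose]
  simp only [Matrix.mul_inv_rev]
  rw [Matrix.mul_nonsing_inv_cancel_left _ _ hE, Matrix.nonsing_inv_mul_cancel_right _ _ hE']

theorem interiorAt_conj (hE : IsUnit E.det) (α : Fin 4 → ℝ) (M : Matrix (Fin 4) (Fin 4) ℝ) :
    interiorAt (Eᵀ * G * E) (α ᵥ* E) (Eᵀ * M * E) = interiorAt G α M ᵥ* E := by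
  have h : E *ᵥ ((Eᵀ * G * E)⁻¹ *ᵥ (α ᵥ* E)) = G⁻¹ *ᵥ α := by
    rw [← Matrix.mulVec_transpose, Matrix.mulVec_mulVec, Matrix.mulVec_mulVec, mul_inv_conj hE]
  rw [interiorAt, interiorAt, ← h, ← Matrix.vecMul_vecMul, ← Matrix.vecMul_vecMul,
    Matrix.vecMul_transpose]

theorem negDiv_eq (G : Matrix (Fin 4) (Fin 4) ℝ) (T : Fin 4 → Matrix (Fin 4) (Fin 4) ℝ) :
    negDiv G T = - ∑ p, G⁻¹.col p ᵥ* T p := by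
  funext d
  rw [negDiv, Finset.sum_comm, Pi.neg_apply, Finset.sum_apply]
  rfl

theorem negDiv_conj (hE : IsUnit E.det) :
    negDiv (Eᵀ * G * E) (changeBasis E T) = negDiv G T ᵥ* E := by
  rw [negDiv_eq, negDiv_eq, Matrix.neg_vecMul, Matrix.sum_vecMul]
  congr 1
  simp only [changeBasis, Matrix.vecMul_sum]
  rw [Finset.sum_comm]
  refine Finset.sum_congr rfl fun c _ => ?_
  rw [← mul_inv_conj (G := G) hE]
  have h : ∑ k, E c k • ((Eᵀ * G * E)⁻¹.col k) = ((Eᵀ * G * E)⁻¹ * Eᵀ).col c := by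
    ext i
    simp [Matrix.mul_apply, mul_comm]
  have h2 : ∀ A B : Matrix (Fin 4) (Fin 4) ℝ, A *ᵥ B.col c = (A * B).col c := fun A B => rfl
  simp only [Matrix.vecMul_smul, ← Matrix.smul_vecMul]
  rw [← Matrix.sum_vecMul, h, ← Matrix.vecMul_vecMul, ← Matrix.vecMul_vecMul,
    Matrix.vecMul_transpose, h2, Matrix.mul_assoc E]

theorem wedgeMetric_conj (α : Fin 4 → ℝ) :
    wedgeMetric (Eᵀ * G * E) (α ᵥ* E) = changeBasis E (wedgeMetric G α) := by
  funext k
  have h : (Eᵀ * G * E) k = ∑ c, E c k • (G c ᵥ* E) := by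
    funext j
    simp only [Matrix.mul_apply, Matrix.transpose_apply, Finset.sum_apply, Pi.smul_apply,
      Matrix.vecMul, dotProduct, smul_eq_mul, Finset.sum_mul, Finset.mul_sum]
    rw [Finset.sum_comm]
    refine Finset.sum_congr rfl fun c _ => Finset.sum_congr rfl fun a _ => ?_
    ring
  simp only [changeBasis, wedgeMetric, h, Matrix.mul_sub, Matrix.sub_mul, Matrix.mul_vecMulVec,
    Matrix.vecMulVec_mul, Matrix.mulVec_transpose]
  ext i j
  simp only [Matrix.sub_apply, vecMulVec_apply, Finset.sum_apply, Pi.smul_apply, smul_eq_mul,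
    Matrix.sum_apply, Matrix.smul_apply, Finset.mul_sum, Finset.sum_mul]
  rw [← Finset.sum_sub_distrib]
  refine Finset.sum_congr rfl fun c _ => ?_
  ring

variable {U : Matrix (Fin 4) (Fin 4) ℝ}

theorem phiAt_conj (hE : 0 < E.det) :
    phiAt (Eᵀ * G * E) (Eᵀ * U * E) (changeBasis E T) = phiAt G U T ᵥ* E := by
  have hu := hE.ne'.isUnit
  rw [phiAt, phiAt, hodgeAt_conj _ _ _ hE, changeBasis_hodgeAt hE, negDiv_conj hu, negDiv_conj hu,
    interiorAt_conj hu, interiorAt_conj hu, Matrix.sub_vecMul]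

theorem psiAt_conj (hE : 0 < E.det) :
    psiAt (Eᵀ * G * E) (Eᵀ * U * E) (changeBasis E T) = psiAt G U T ᵥ* E := by
  have hu := hE.ne'.isUnit
  rw [psiAt, psiAt, hodgeAt_conj _ _ _ hE, changeBasis_hodgeAt hE, negDiv_conj hu, negDiv_conj hu,
    interiorAt_conj hu, interiorAt_conj hu, Matrix.sub_vecMul, Matrix.neg_vecMul]

theorem umbilicAt_conj (hE : 0 < E.det) :
    umbilicAt (Eᵀ * G * E) (Eᵀ * U * E) (changeBasis E T) = changeBasis E (umbilicAt G U T) := by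
  have hu := hE.ne'.isUnit
  have h1 : umbilicAt G U T = T - (1 / 2 : ℝ) • ((fun c => phiAt G U T c • U) +
      fun c => psiAt G U T c • hodgeAt G U) - (1 / 2 : ℝ) • (wedgeMetric G (negDiv G T)
        - fun c => hodgeAt G (wedgeMetric G (negDiv G fun c => hodgeAt G (T c)) c)) := rfl
  rw [h1, changeBasis_sub, changeBasis_sub, changeBasis_smul, changeBasis_smul, changeBasis_add,
    changeBasis_sub, changeBasis_tensor, changeBasis_tensor, ← wedgeMetric_conj,
    ← changeBasis_hodgeAt hE, ← wedgeMetric_conj, ← negDiv_conj hu, ← negDiv_conj hu,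
    ← hodgeAt_conj _ _ _ hE, ← phiAt_conj hE, ← psiAt_conj hE, ← changeBasis_hodgeAt hE]
  rfl

theorem covCanonicalAt_conj (hE : 0 < E.det) (C s : ℝ) (a b : Fin 4 → ℝ) :
    covCanonicalAt (Eᵀ * G * E) (Eᵀ * U * E) (changeBasis E T) C s (a ᵥ* E) (b ᵥ* E) =
      changeBasis E (covCanonicalAt G U T C s a b) := by
  have h1 : covCanonicalAt G U T C s a b = C • ((fun c => a c • U) + (fun c => b c • hodgeAt G U) +
      T) + s • ((fun c => a c • hodgeAt G U) - (fun c => b c • U) +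
        fun c => hodgeAt G (T c)) := rfl
  rw [h1, changeBasis_add, changeBasis_smul, changeBasis_smul, changeBasis_add, changeBasis_add,
    changeBasis_add, changeBasis_sub, changeBasis_tensor, changeBasis_tensor, changeBasis_tensor,
    changeBasis_tensor, ← changeBasis_hodgeAt hE, ← hodgeAt_conj _ _ _ hE]
  rfl

end ChangeBasis

/-! ### The Killing-Yano equation in an adapted frame -/

/-- The components in an adapted frame of the derivative of a unitary 2-form: it has no components
along the form and its dual. -/
def mixedForm (x y z w : Fin 4 → ℝ) (c : Fin 4) : Matrix (Fin 4) (Fin 4) ℝ :=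
  !![0, 0, x c, y c; 0, 0, z c, w c; - x c, - z c, 0, 0; - y c, - w c, 0, 0]

theorem mixedForm_skew (x y z w : Fin 4 → ℝ) (c : Fin 4) :
    (mixedForm x y z w c)ᵀ = - mixedForm x y z w c := by
  ext a b
  fin_cases a <;> fin_cases b <;> simp [mixedForm]

theorem hodgeAt_mixedForm (x y z w : Fin 4 → ℝ) (c : Fin 4) :
    hodgeAt minkowski (mixedForm x y z w c) = mixedForm (-w) z (-y) x c := by
  rw [hodgeAt_minkowski _ (skew_of_transpose (mixedForm_skew x y z w c))]
  ext a b
  fin_cases a <;> fin_cases b <;> simp [mixedForm]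

theorem exists_mixedForm {T : Fin 4 → Matrix (Fin 4) (Fin 4) ℝ} (hT : ∀ c, (T c)ᵀ = -(T c))
    (h01 : ∀ c, T c 0 1 = 0) (h23 : ∀ c, T c 2 3 = 0) :
    ∃ x y z w, T = mixedForm x y z w := by
  refine ⟨fun c => T c 0 2, fun c => T c 0 3, fun c => T c 1 2, fun c => T c 1 3, ?_⟩
  funext c
  have hs := skew_of_transpose (hT c)
  have h1 := h01 c
  have h2 := h23 c
  have h00 := hs 0 0
  have h11 := hs 1 1
  have h22 := hs 2 2
  have h33 := hs 3 3
  have h10 := hs 1 0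
  have h20 := hs 2 0
  have h30 := hs 3 0
  have h21 := hs 2 1
  have h31 := hs 3 1
  have h32 := hs 3 2
  ext a b
  fin_cases a <;> fin_cases b <;> simp [mixedForm] <;> linarith

theorem negDiv_mixedForm (x y z w : Fin 4 → ℝ) :
    negDiv minkowski (mixedForm x y z w) = ![x 2 + y 3, z 2 + w 3, x 0 - z 1, y 0 - w 1] := by
  funext d
  rw [negDiv, minkowski_inv, minkowski]
  fin_cases d <;> simp [Fin.sum_univ_four, Matrix.diagonal, mixedForm] <;> ring

theorem interiorAt_unitaryNormal (α : Fin 4 → ℝ) :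
    interiorAt minkowski α unitaryNormal = ![α 1, α 0, 0, 0] := by
  funext d
  rw [interiorAt, minkowski_inv, minkowski]
  fin_cases d <;>
    simp [Matrix.vecMul, dotProduct, Matrix.mulVec_diagonal, Fin.sum_univ_four, unitaryNormal]

theorem interiorAt_unitaryDual (α : Fin 4 → ℝ) :
    interiorAt minkowski α unitaryDual = ![0, 0, - α 3, α 2] := by
  funext d
  rw [interiorAt, minkowski_inv, minkowski]
  fin_cases d <;>
    simp [Matrix.vecMul, dotProduct, Matrix.mulVec_diagonal, Fin.sum_univ_four, unitaryDual]

theorem wedgeMetric_skew (G : Matrix (Fin 4) (Fin 4) ℝ) (α : Fin 4 → ℝ) (c : Fin 4) :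
    (wedgeMetric G α c)ᵀ = - wedgeMetric G α c := by
  simp [wedgeMetric, Matrix.transpose_vecMulVec]

theorem wedgeMetric_minkowski (α : Fin 4 → ℝ) : wedgeMetric minkowski α =
    ![!![0, α 1, α 2, α 3; -α 1, 0, 0, 0; -α 2, 0, 0, 0; -α 3, 0, 0, 0],
      !![0, α 0, 0, 0; -α 0, 0, -α 2, -α 3; 0, α 2, 0, 0; 0, α 3, 0, 0],
      !![0, 0, α 0, 0; 0, 0, α 1, 0; -α 0, -α 1, 0, -α 3; 0, 0, α 3, 0],
      !![0, 0, 0, α 0; 0, 0, 0, α 1; 0, 0, 0, α 2; -α 0, -α 1, -α 2, 0]] := by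
  funext c
  ext i j
  fin_cases c <;> fin_cases i <;> fin_cases j <;>
    simp [wedgeMetric, vecMulVec_apply, minkowski]

theorem hodgeAt_wedgeMetric_minkowski (α : Fin 4 → ℝ) :
    (fun c => hodgeAt minkowski (wedgeMetric minkowski α c)) =
    ![!![0, 0, 0, 0; 0, 0, -α 3, α 2; 0, α 3, 0, -α 1; 0, -α 2, α 1, 0],
      !![0, 0, α 3, -α 2; 0, 0, 0, 0; -α 3, 0, 0, -α 0; α 2, 0, α 0, 0],
      !![0, -α 3, 0, α 1; α 3, 0, 0, α 0; 0, 0, 0, 0; -α 1, -α 0, 0, 0],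
      !![0, α 2, -α 1, 0; -α 2, 0, -α 0, 0; α 1, α 0, 0, 0; 0, 0, 0, 0]] := by
  funext c
  rw [hodgeAt_minkowski _ (skew_of_transpose (wedgeMetric_skew _ _ _)), wedgeMetric_minkowski]
  fin_cases c <;> simp

/-- The solutions of the Killing-Yano equation in an adapted frame: for given
`ψ`, the derivative of the unitary form, `dφ` and `dψ` depend linearly on four numbers. -/
theorem exists_parameters {x y z w a b : Fin 4 → ℝ} {C s : ℝ} (hCs : C ^ 2 + s ^ 2 = 1)
    (h : IsKillingAt (covCanonicalAt minkowski unitaryNormal (mixedForm x y z w) C s a b)) :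
    ∃ p q m n, x = ![-(s * n), C * p, -(s * m), C * q] ∧ y = ![s * p, C * n, -(C * q), -(s * m)] ∧
      z = ![-(C * p), s * n, -(s * q), C * m] ∧ w = ![-(C * n), -(s * p), -(C * m), -(s * q)] ∧
      a = ![s * q, s * m, C * p, C * n] ∧ b = ![C * q, C * m, -(s * p), -(s * n)] := by
  have h' : ∀ c i j, covCanonicalAt minkowski unitaryNormal (mixedForm x y z w) C s a b c i j =
      C * (a c * unitaryNormal i j + b c * unitaryDual i j + mixedForm x y z w c i j) +
      s * (a c * unitaryDual i j - b c * unitaryNormal i j + mixedForm (-w) z (-y) x c i j) := by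
    intro c i j
    simp only [covCanonicalAt, hodgeAt_unitaryNormal, hodgeAt_mixedForm, Matrix.add_apply,
      Matrix.sub_apply, Matrix.smul_apply, smul_eq_mul]
  simp only [IsKillingAt, h'] at h
  have k001 := h 0 0 1
  have k002 := h 0 0 2
  have k003 := h 0 0 3
  have k110 := h 1 1 0
  have k112 := h 1 1 2
  have k113 := h 1 1 3
  have k220 := h 2 2 0
  have k221 := h 2 2 1
  have k223 := h 2 2 3
  have k330 := h 3 3 0
  have k331 := h 3 3 1
  have k332 := h 3 3 2
  have k012 := h 0 1 2
  have k013 := h 0 1 3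
  have k021 := h 0 2 1
  have k023 := h 0 2 3
  have k031 := h 0 3 1
  have k032 := h 0 3 2
  have k120 := h 1 2 0
  have k123 := h 1 2 3
  have k130 := h 1 3 0
  have k132 := h 1 3 2
  have k230 := h 2 3 0
  have k231 := h 2 3 1
  simp [mixedForm, unitaryNormal, unitaryDual] at k001 k002 k003 k110 k112 k113 k220 k221 k223
  simp [mixedForm, unitaryNormal, unitaryDual] at k330 k331 k332 k012 k013 k021 k023 k031
  simp [mixedForm, unitaryNormal, unitaryDual] at k032 k120 k123 k130 k132 k230 k231
  -- The combinations below are, up to sign, the components of `e^{-φ} ∇A`, which `h` makes totally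
  -- antisymmetric.
  have hX0 : C * x 0 - s * w 0 = 0 := by linarith
  have hX1 : C * x 1 - s * w 1 = C * a 2 - s * b 2 := by linarith
  have hX2 : C * x 2 - s * w 2 = 0 := by linarith
  have hX3 : C * x 3 - s * w 3 = C * b 0 + s * a 0 := by linarith
  have hY0 : C * y 0 + s * z 0 = 0 := by linarith
  have hY1 : C * y 1 + s * z 1 = C * a 3 - s * b 3 := by linarith
  have hY2 : C * y 2 + s * z 2 = -(C * b 0 + s * a 0) := by linarith
  have hY3 : C * y 3 + s * z 3 = 0 := by linarith
  have hZ0 : C * z 0 - s * y 0 = -(C * a 2 - s * b 2) := by linarith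
  have hZ1 : C * z 1 - s * y 1 = 0 := by linarith
  have hZ2 : C * z 2 - s * y 2 = 0 := by linarith
  have hZ3 : C * z 3 - s * y 3 = C * b 1 + s * a 1 := by linarith
  have hW0 : C * w 0 + s * x 0 = -(C * a 3 - s * b 3) := by linarith
  have hW1 : C * w 1 + s * x 1 = 0 := by linarith
  have hW2 : C * w 2 + s * x 2 = -(C * b 1 + s * a 1) := by linarith
  have hW3 : C * w 3 + s * x 3 = 0 := by linarith
  have hα0 : C * a 0 - s * b 0 = 0 := by linarith
  have hα1 : C * a 1 - s * b 1 = 0 := by linarith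
  have hβ2 : C * b 2 + s * a 2 = 0 := by linarith
  have hβ3 : C * b 3 + s * a 3 = 0 := by linarith
  refine ⟨C * a 2 - s * b 2, C * b 0 + s * a 0, C * b 1 + s * a 1, C * a 3 - s * b 3,
    ?_, ?_, ?_, ?_, ?_, ?_⟩
  · ext i
    fin_cases i <;> simp
    · linear_combination C * hX0 + s * hW0 - x 0 * hCs
    · linear_combination C * hX1 + s * hW1 - x 1 * hCs
    · linear_combination C * hX2 + s * hW2 - x 2 * hCs
    · linear_combination C * hX3 + s * hW3 - x 3 * hCs
  · ext i
    fin_cases i <;> simp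
    · linear_combination C * hY0 - s * hZ0 - y 0 * hCs
    · linear_combination C * hY1 - s * hZ1 - y 1 * hCs
    · linear_combination C * hY2 - s * hZ2 - y 2 * hCs
    · linear_combination C * hY3 - s * hZ3 - y 3 * hCs
  · ext i
    fin_cases i <;> simp
    · linear_combination C * hZ0 + s * hY0 - z 0 * hCs
    · linear_combination C * hZ1 + s * hY1 - z 1 * hCs
    · linear_combination C * hZ2 + s * hY2 - z 2 * hCs
    · linear_combination C * hZ3 + s * hY3 - z 3 * hCs
  · ext i
    fin_cases i <;> simp
    · linear_combination C * hW0 - s * hX0 - w 0 * hCs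
    · linear_combination C * hW1 - s * hX1 - w 1 * hCs
    · linear_combination C * hW2 - s * hX2 - w 2 * hCs
    · linear_combination C * hW3 - s * hX3 - w 3 * hCs
  · ext i
    fin_cases i <;> simp
    · linear_combination C * hα0 - a 0 * hCs
    · linear_combination C * hα1 - a 1 * hCs
    · linear_combination s * hβ2 - a 2 * hCs
    · linear_combination s * hβ3 - a 3 * hCs
  · ext i
    fin_cases i <;> simp
    · linear_combination -(s * hα0) - b 0 * hCs
    · linear_combination -(s * hα1) - b 1 * hCs
    · linear_combination C * hβ2 - b 2 * hCs
    · linear_combination C * hβ3 - b 3 * hCs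

/-- In an adapted frame the Killing-Yano equation implies `2 dφ = -Φ`, `2 dψ = -Ψ`, umbilicity, and
`cos ψ δU + sin ψ δ*U = 0`: all of them are read off from the parametrized solution. -/
theorem frame_of_isKillingAt {x y z w a b : Fin 4 → ℝ} {C s : ℝ} (hCs : C ^ 2 + s ^ 2 = 1)
    (h : IsKillingAt (covCanonicalAt minkowski unitaryNormal (mixedForm x y z w) C s a b)) :
    2 • a + phiAt minkowski unitaryNormal (mixedForm x y z w) = 0 ∧
      2 • b + psiAt minkowski unitaryNormal (mixedForm x y z w) = 0 ∧
      umbilicAt minkowski unitaryNormal (mixedForm x y z w) = 0 ∧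
      C • negDiv minkowski (mixedForm x y z w) +
        s • negDiv minkowski (fun c => hodgeAt minkowski (mixedForm x y z w c)) = 0 := by
  obtain ⟨p, q, m, n, hx, hy, hz, hw, ha, hb⟩ := exists_parameters hCs h
  have hd : (fun c => hodgeAt minkowski (mixedForm x y z w c)) = mixedForm (-w) z (-y) x :=
    funext (hodgeAt_mixedForm x y z w)
  have hp : negDiv minkowski (mixedForm x y z w) =
      ![-(2 * s * m), -(2 * s * q), -(2 * s * n), 2 * s * p] := by
    rw [negDiv_mixedForm, hx, hy, hz, hw]
    ext i
    fin_cases i <;> simp <;> ring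
  have hq : negDiv minkowski (mixedForm (-w) z (-y) x) =
      ![2 * C * m, 2 * C * q, 2 * C * n, -(2 * C * p)] := by
    rw [negDiv_mixedForm, hx, hy, hz, hw]
    ext i
    fin_cases i <;> simp <;> ring
  have hΦ : phiAt minkowski unitaryNormal (mixedForm x y z w) =
      ![-(2 * s * q), -(2 * s * m), -(2 * C * p), -(2 * C * n)] := by
    rw [phiAt, hd, hp, hq, hodgeAt_unitaryNormal, interiorAt_unitaryNormal, interiorAt_unitaryDual]
    ext i
    fin_cases i <;> simp
  have hΨ : psiAt minkowski unitaryNormal (mixedForm x y z w) =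
      ![-(2 * C * q), -(2 * C * m), 2 * s * p, 2 * s * n] := by
    rw [psiAt, hd, hp, hq, hodgeAt_unitaryNormal, interiorAt_unitaryNormal, interiorAt_unitaryDual]
    ext i
    fin_cases i <;> simp
  refine ⟨?_, ?_, ?_, ?_⟩
  · rw [hΦ, ha]
    ext i
    fin_cases i <;> simp <;> ring
  · rw [hΨ, hb]
    ext i
    fin_cases i <;> simp <;> ring
  · funext c
    have hW := fun α => congrFun (hodgeAt_wedgeMetric_minkowski α) c
    rw [umbilicAt, hΦ, hΨ, hd, hp, hq, hW, wedgeMetric_minkowski, hodgeAt_unitaryNormal, hx, hy, hz,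
      hw]
    fin_cases c <;> simp [mixedForm, unitaryNormal, unitaryDual] <;> ext i j <;>
      fin_cases i <;> fin_cases j <;> simp <;> ring
  · rw [hd, hp, hq]
    ext i
    fin_cases i <;> simp <;> ring

/-! ### The Killing-Yano equation at a point -/

theorem pairing_unitaryNormal {F : Matrix (Fin 4) (Fin 4) ℝ} (hF : Fᵀ = -F) :
    pairing minkowski unitaryNormal F = 2 * F 0 1 ∧
      pairing minkowski F unitaryNormal = 2 * F 0 1 ∧
      pairing minkowski F unitaryDual = 2 * F 2 3 := by
  have h1 := skew_of_transpose hF 1 0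
  have h2 := skew_of_transpose hF 3 2
  refine ⟨?_, ?_, ?_⟩ <;> rw [pairing_minkowski] <;>
    simp [Fin.sum_univ_four, unitaryNormal, unitaryDual] <;> linarith

/-- The pointwise content of the Killing-Yano equation: it determines `dφ` and `dψ` and makes the
umbilicity tensor vanish. The hypotheses on `T = ∇U` are the derivatives of the algebraic
constraints on a unitary 2-form. -/
theorem HasAdaptedFrame.of_isKillingAt {G U : Matrix (Fin 4) (Fin 4) ℝ} (h : HasAdaptedFrame G U)
    {T : Fin 4 → Matrix (Fin 4) (Fin 4) ℝ} (hT : ∀ c, (T c)ᵀ = -(T c))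
    (h₁ : ∀ c, pairing G U (T c) + pairing G (T c) U = 0)
    (h₂ : ∀ c, pairing G U (hodgeAt G (T c)) + pairing G (T c) (hodgeAt G U) = 0)
    {C s : ℝ} (hCs : C ^ 2 + s ^ 2 = 1) {a b : Fin 4 → ℝ}
    (hK : IsKillingAt (covCanonicalAt G U T C s a b)) :
    2 • a + phiAt G U T = 0 ∧ 2 • b + psiAt G U T = 0 ∧ umbilicAt G U T = 0 ∧
      C • negDiv G T + s • negDiv G (fun c => hodgeAt G (T c)) = 0 := by
  obtain ⟨E, hE, hG, hU⟩ := h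
  have hu := hE.ne'.isUnit
  have hskew : ∀ k, (changeBasis E T k)ᵀ = -(changeBasis E T k) := by
    intro k
    simp only [changeBasis, Matrix.transpose_sum, Matrix.transpose_smul,
      transpose_conj_of_skew (hT _), smul_neg, Finset.sum_neg_distrib]
  have hentry : ∀ k i j, changeBasis E T k i j = ∑ c, E c k * (Eᵀ * T c * E) i j := by
    intro k i j
    simp [changeBasis, Matrix.sum_apply]
  have h01 : ∀ c, (Eᵀ * T c * E) 0 1 = 0 := by
    intro c
    have h3 := h₁ c
    rw [← pairing_conj E G U (T c) hu, ← pairing_conj E G (T c) U hu, hG, hU] at h3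
    have h4 := pairing_unitaryNormal (transpose_conj_of_skew (E := E) (hT c))
    rw [h4.1, h4.2.1] at h3
    linarith
  have h23 : ∀ c, (Eᵀ * T c * E) 2 3 = 0 := by
    intro c
    have h3 := h₂ c
    have hs := transpose_conj_of_skew (E := E) (hT c)
    rw [← pairing_conj E G U _ hu, ← pairing_conj E G (T c) _ hu, ← hodgeAt_conj _ _ _ hE,
      ← hodgeAt_conj _ _ _ hE, hG, hU, hodgeAt_unitaryNormal, (pairing_unitaryNormal hs).2.2,
      (pairing_unitaryNormal (transpose_of_skew (hodgeAt_skew _ _))).1,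
      hodgeAt_minkowski _ (skew_of_transpose hs)] at h3
    simp only [Matrix.of_apply, Matrix.cons_val] at h3
    linarith
  obtain ⟨x, y, z, w, hxyz⟩ := exists_mixedForm hskew
    (fun k => by rw [hentry]; simp [h01]) (fun k => by rw [hentry]; simp [h23])
  have hK' := isKillingAt_changeBasis (E := E) hK
  rw [← covCanonicalAt_conj hE, hG, hU, hxyz] at hK'
  obtain ⟨r1, r2, r3, r4⟩ := frame_of_isKillingAt hCs hK'
  have hinj : ∀ v : Fin 4 → ℝ, v ᵥ* E = 0 → v = 0 := by
    intro v hv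
    have := congrArg (· ᵥ* E⁻¹) hv
    simpa [Matrix.vecMul_vecMul, Matrix.mul_nonsing_inv _ hu] using this
  rw [← hxyz] at r1 r2 r3 r4
  rw [← hG, ← hU, phiAt_conj hE] at r1
  rw [← hG, ← hU, psiAt_conj hE] at r2
  rw [← hG, ← hU, umbilicAt_conj hE] at r3
  rw [← hG, changeBasis_hodgeAt hE, negDiv_conj hu, negDiv_conj hu] at r4
  refine ⟨hinj _ ?_, hinj _ ?_, eq_zero_of_changeBasis hu r3, hinj _ ?_⟩
  · rw [← r1, Matrix.add_vecMul, Matrix.smul_vecMul]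
  · rw [← r2, Matrix.add_vecMul, Matrix.smul_vecMul]
  · rw [← r4, Matrix.add_vecMul, Matrix.smul_vecMul, Matrix.smul_vecMul]

/-- The dual of `α^d G_{dcab}` is `α^d η_{dcab}`. -/
theorem hodgeAt_wedgeMetric {G : Matrix (Fin 4) (Fin 4) ℝ} (hG : Gᵀ = G) (hu : IsUnit G.det)
    (α : Fin 4 → ℝ) (c a b : Fin 4) :
    hodgeAt G (wedgeMetric G α c) a b =
      ∑ d, (G⁻¹ *ᵥ α) d * (Real.sqrt |G.det| * leviCivita d c a b) := by
  have hGc : G⁻¹ *ᵥ G c = Pi.single c 1 := by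
    have h1 : G c = G *ᵥ Pi.single c 1 := by
      rw [Matrix.mulVec_single_one]
      conv_lhs => rw [← hG]
      rfl
    rw [h1, Matrix.mulVec_mulVec, Matrix.nonsing_inv_mul _ hu, Matrix.one_mulVec]
  have hR : G⁻¹ * wedgeMetric G α c * G⁻¹ᵀ =
      vecMulVec (G⁻¹ *ᵥ α) (Pi.single c 1) - vecMulVec (Pi.single c 1) (G⁻¹ *ᵥ α) := by
    rw [wedgeMetric, Matrix.mul_sub, Matrix.sub_mul, Matrix.mul_vecMulVec, Matrix.mul_vecMulVec,
      Matrix.vecMulVec_mul, Matrix.vecMulVec_mul, Matrix.vecMul_transpose, Matrix.vecMul_transpose,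
      hGc]
  rw [hodgeAt_eq, hR]
  simp only [Matrix.smul_apply, epsDual, Matrix.of_apply, Matrix.sub_apply, vecMulVec_apply,
    sub_mul, Finset.sum_sub_distrib, smul_eq_mul]
  have h1 : ∀ d, ∑ e, (G⁻¹ *ᵥ α) d * (Pi.single c 1 : Fin 4 → ℝ) e * leviCivita d e a b =
      (G⁻¹ *ᵥ α) d * leviCivita d c a b := by
    intro d
    rw [Finset.sum_eq_single c (fun e _ he => by simp [he]) (by simp)]
    simp
  have h2 : ∑ d, ∑ e, (Pi.single c 1 : Fin 4 → ℝ) d * (G⁻¹ *ᵥ α) e * leviCivita d e a b =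
      - ∑ d, (G⁻¹ *ᵥ α) d * leviCivita d c a b := by
    rw [Finset.sum_eq_single c (fun e _ he => by simp [he]) (by simp), ← Finset.sum_neg_distrib]
    refine Finset.sum_congr rfl fun d _ => ?_
    rw [leviCivita_eq, leviCivita_eq]
    simp
    ring
  rw [Finset.sum_congr rfl fun d _ => h1 d, h2, sub_neg_eq_add, ← two_mul, ← mul_assoc, ← mul_assoc,
    Finset.mul_sum]
  refine Finset.sum_congr rfl fun d _ => ?_
  ring

theorem isKillingAt_hodgeAt_wedgeMetric {G : Matrix (Fin 4) (Fin 4) ℝ} (hG : Gᵀ = G)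
    (hu : IsUnit G.det) (α : Fin 4 → ℝ) : IsKillingAt fun c => hodgeAt G (wedgeMetric G α c) := by
  intro c a b
  simp only [hodgeAt_wedgeMetric hG hu]
  rw [← Finset.sum_add_distrib]
  refine Finset.sum_eq_zero fun d _ => ?_
  rw [leviCivita_eq, leviCivita_eq]
  ring

theorem hodgeAt_neg (G F : Matrix (Fin 4) (Fin 4) ℝ) : hodgeAt G (-F) = - hodgeAt G F := by
  rw [← neg_one_smul ℝ F, hodgeAt_smul, neg_one_smul]

theorem hodgeAt_sub (G F H : Matrix (Fin 4) (Fin 4) ℝ) :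
    hodgeAt G (F - H) = hodgeAt G F - hodgeAt G H := by
  rw [sub_eq_add_neg, hodgeAt_add, hodgeAt_neg, ← sub_eq_add_neg]

theorem wedgeMetric_zero (G : Matrix (Fin 4) (Fin 4) ℝ) (c : Fin 4) : wedgeMetric G 0 c = 0 := by
  ext i j
  simp [wedgeMetric]

theorem wedgeMetric_sub_smul (G : Matrix (Fin 4) (Fin 4) ℝ) (α β : Fin 4 → ℝ) (r t : ℝ)
    (c : Fin 4) :
    wedgeMetric G (r • α - t • β) c = r • wedgeMetric G α c - t • wedgeMetric G β c := by
  ext i j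
  simp [wedgeMetric, vecMulVec_apply]
  ring

/-- The dual of the umbilicity tensor. -/
theorem HasAdaptedFrame.hodgeAt_umbilicAt {G U : Matrix (Fin 4) (Fin 4) ℝ}
    (h : HasAdaptedFrame G U) (T : Fin 4 → Matrix (Fin 4) (Fin 4) ℝ) (c : Fin 4) :
    hodgeAt G (umbilicAt G U T c) =
      hodgeAt G (T c) - (1 / 2 : ℝ) • (phiAt G U T c • hodgeAt G U - psiAt G U T c • U)
        - (1 / 2 : ℝ) • (hodgeAt G (wedgeMetric G (negDiv G T) c)
          + wedgeMetric G (negDiv G fun c => hodgeAt G (T c)) c) := by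
  rw [umbilicAt, hodgeAt_sub, hodgeAt_sub, hodgeAt_smul, hodgeAt_smul, hodgeAt_add, hodgeAt_smul,
    hodgeAt_smul, hodgeAt_sub, h.hodgeAt_hodgeAt h.transpose_form,
    h.hodgeAt_hodgeAt (wedgeMetric_skew _ _ _), smul_neg, sub_neg_eq_add, ← sub_eq_add_neg]

/-- The pointwise sufficient conditions for the Killing-Yano equation: under them `∇A` is
`e^φ / 2` times the contraction of the volume element with `sin ψ δU - cos ψ δ*U`. -/
theorem HasAdaptedFrame.isKillingAt {G U : Matrix (Fin 4) (Fin 4) ℝ} (h : HasAdaptedFrame G U)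
    {T : Fin 4 → Matrix (Fin 4) (Fin 4) ℝ} {C s : ℝ} {a b : Fin 4 → ℝ}
    (ha : ∀ c, 2 * a c + phiAt G U T c = 0) (hb : ∀ c, 2 * b c + psiAt G U T c = 0)
    (hX : ∀ c, umbilicAt G U T c = 0)
    (hpq : ∀ d, C * negDiv G T d + s * negDiv G (fun c => hodgeAt G (T c)) d = 0) :
    IsKillingAt (covCanonicalAt G U T C s a b) := by
  set p := negDiv G T with hp
  set q := negDiv G (fun c => hodgeAt G (T c)) with hq
  have key : ∀ c, covCanonicalAt G U T C s a b c =
      (1 / 2 : ℝ) • hodgeAt G (wedgeMetric G (s • p - C • q) c) := by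
    intro c
    have hX1 := hX c
    have hX2 := h.hodgeAt_umbilicAt T c
    rw [hX1, hodgeAt_zero] at hX2
    have hN : C • wedgeMetric G p c + s • wedgeMetric G q c = 0 := by
      have h1 := wedgeMetric_sub_smul G p q C (-s) c
      have h2 : C • p - (-s) • q = 0 := by
        funext d
        simpa using hpq d
      rw [h2] at h1
      rw [wedgeMetric_zero, neg_smul, sub_neg_eq_add] at h1
      exact h1.symm
    rw [wedgeMetric_sub_smul, hodgeAt_sub, hodgeAt_smul, hodgeAt_smul]
    ext i j
    have e1 := congrFun (congrFun hX1 i) j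
    have e2 := congrFun (congrFun hX2 i) j
    have e3 := congrFun (congrFun hN i) j
    simp only [umbilicAt, Matrix.sub_apply, Matrix.add_apply, Matrix.smul_apply, smul_eq_mul,
      Matrix.zero_apply, ← hp, ← hq] at e1 e2 e3
    simp only [covCanonicalAt, Matrix.sub_apply, Matrix.add_apply, Matrix.smul_apply, smul_eq_mul]
    linear_combination C * e1 - s * e2 + (1 / 2) * e3 +
      (C * U i j + s * hodgeAt G U i j) / 2 * ha c + (C * hodgeAt G U i j - s * U i j) / 2 * hb c
  intro c i j
  have h1 := isKillingAt_hodgeAt_wedgeMetric h.transpose_metric h.isUnit_det (s • p - C • q) c i j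
  rw [key, key, Matrix.smul_apply, Matrix.smul_apply, smul_eq_mul, smul_eq_mul]
  linear_combination (1 / 2) * h1

/-! ### The chart-level form of the equations -/

namespace IsUnitaryPairOn

variable {g U : Tensor2} {O : Set Coord} {y : Coord}

theorem phiForm_eq (h : IsUnitaryPairOn g U O) (hy : y ∈ O) :
    phiForm g U y = phiAt (g y) (U y) (covMatrix g U y) := by
  rw [phiAt, ← h.codiff_form hy, ← h.codiff_dual hy]
  rfl

theorem psiForm_eq (h : IsUnitaryPairOn g U O) (hy : y ∈ O) :
    psiForm g U y = psiAt (g y) (U y) (covMatrix g U y) := by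
  rw [psiAt, ← h.codiff_form hy, ← h.codiff_dual hy]
  rfl

/-- Lowering the raised index of a 1-form gives it back. -/
theorem lower_raise (h : IsUnitaryPairOn g U O) (hy : y ∈ O) (α : Fin 4 → ℝ) (a : Fin 4) :
    ∑ d, ((g y)⁻¹ *ᵥ α) d * g y d a = α a := by
  have h1 : (g y *ᵥ ((g y)⁻¹ *ᵥ α)) a = α a := by
    rw [Matrix.mulVec_mulVec, Matrix.mul_nonsing_inv _ (h.frame y hy).isUnit_det, Matrix.one_mulVec]
  rw [← h1, Matrix.mulVec, dotProduct]
  refine Finset.sum_congr rfl fun d _ => ?_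
  have h2 : g y d a = g y a d := congrFun (congrFun (h.frame y hy).transpose_metric a) d
  rw [h2, mul_comm]

/-- The umbilicity tensor is `(1/√2) (X - i *X)` for the real tensor `X` given by `umbilicAt`. -/
theorem sigmaTensor_eq (h : IsUnitaryPairOn g U O) (hy : y ∈ O) (c a b : Fin 4) :
    sigmaTensor g U y c a b = ((1 / Real.sqrt 2 : ℝ) : ℂ) *
      ((umbilicAt (g y) (U y) (covMatrix g U y) c a b : ℂ) -
        Complex.I * (hodgeAt (g y) (umbilicAt (g y) (U y) (covMatrix g U y) c) a b : ℂ)) := by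
  have hfr := h.frame y hy
  set r : ℂ := ((1 / Real.sqrt 2 : ℝ) : ℂ) with hr
  have hr2 : r * r = 1 / 2 := by
    rw [hr, ← Complex.ofReal_mul]
    have : (1 / Real.sqrt 2) * (1 / Real.sqrt 2) = (1 / 2 : ℝ) := by
      rw [div_mul_div_comm, one_mul, Real.mul_self_sqrt (by norm_num)]
    rw [this]
    norm_num
  set p := codiff g U y with hp
  set q := codiff g (hodge2 g U) y with hq
  have hup : ∀ d, codiffSelfDualUp g U y d =
      r * ((((g y)⁻¹ *ᵥ p) d : ℂ) - Complex.I * (((g y)⁻¹ *ᵥ q) d : ℂ)) := by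
    intro d
    simp only [codiffSelfDualUp, codiffSelfDual, ← hp, ← hq, ← hr, Matrix.mulVec, dotProduct,
      Complex.ofReal_sum, Finset.mul_sum, ← Finset.sum_sub_distrib, Complex.ofReal_mul]
    refine Finset.sum_congr rfl fun i _ => ?_
    ring
  have hI := Complex.I_mul_I
  have h1 : ∑ d, codiffSelfDualUp g U y d * selfDual g U y d c =
      r * r * ((phiForm g U y c : ℂ) + Complex.I * (psiForm g U y c : ℂ)) := by
    have hΦ : phiForm g U y c = ∑ d, ((g y)⁻¹ *ᵥ p) d * U y d c -
      ∑ d, ((g y)⁻¹ *ᵥ q) d * hodge2 g U y d c := rfl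
    have hΨ : psiForm g U y c = - ∑ d, ((g y)⁻¹ *ᵥ p) d * hodge2 g U y d c -
      ∑ d, ((g y)⁻¹ *ᵥ q) d * U y d c := rfl
    rw [hΦ, hΨ]
    simp only [hup, selfDual, ← hr]
    push_cast
    simp only [mul_add, mul_sub, mul_neg, Finset.mul_sum, ← Finset.sum_sub_distrib,
      ← Finset.sum_add_distrib, ← Finset.sum_neg_distrib]
    refine Finset.sum_congr rfl fun d _ => ?_
    linear_combination (r * r * (((g y)⁻¹ *ᵥ q) d : ℂ) * (hodge2 g U y d c : ℂ)) * hI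
  have h2 : ∑ d, codiffSelfDualUp g U y d * selfDualMetric g y d c a b =
      r / 2 * (((wedgeMetric (g y) p c a b - hodgeAt (g y) (wedgeMetric (g y) q c) a b : ℝ) : ℂ) -
        Complex.I * ((wedgeMetric (g y) q c a b +
          hodgeAt (g y) (wedgeMetric (g y) p c) a b : ℝ) : ℂ)) := by
    have hN : ∀ α : Fin 4 → ℝ, wedgeMetric (g y) α c a b =
        ∑ d, ((g y)⁻¹ *ᵥ α) d * (g y d a * g y c b - g y d b * g y c a) := by
      intro α
      simp only [mul_sub, ← mul_assoc, Finset.sum_sub_distrib, ← Finset.sum_mul,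
        h.lower_raise hy]
      simp [wedgeMetric, vecMulVec_apply, mul_comm]
    rw [hodgeAt_wedgeMetric hfr.transpose_metric hfr.isUnit_det,
      hodgeAt_wedgeMetric hfr.transpose_metric hfr.isUnit_det, hN, hN]
    simp only [hup, selfDualMetric, vol]
    push_cast
    simp only [mul_sub, mul_add, Finset.mul_sum, ← Finset.sum_sub_distrib,
      ← Finset.sum_add_distrib]
    refine Finset.sum_congr rfl fun d _ => ?_
    linear_combination (r / 2 * (((g y)⁻¹ *ᵥ q) d : ℂ) *
      ((Real.sqrt |(g y).det| : ℂ) * (leviCivita d c a b : ℂ))) * hI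
  rw [sigmaTensor, h1, h2, hfr.hodgeAt_umbilicAt, umbilicAt, ← h.codiff_form hy, ← h.codiff_dual hy,
    ← h.phiForm_eq hy, ← h.psiForm_eq hy, covSelfDual, selfDual, ← hr, ← hp, ← hq, hr2]
  have h3 : cov g (hodge2 g U) y c a b = hodgeAt (g y) (covMatrix g U y c) a b :=
    congrFun (congrFun (h.covMatrix_dual hy c) a) b
  have h4 : cov g U y c a b = covMatrix g U y c a b := rfl
  rw [h3, h4, hodge2_apply]
  simp only [Matrix.sub_apply, Matrix.add_apply, Matrix.smul_apply, smul_eq_mul]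
  push_cast
  linear_combination (r * (psiForm g U y c : ℂ) * (hodgeAt (g y) (U y) a b : ℂ) / 2) * hI

/-- Only the real part of `Σ[U] = 0` matters, since the imaginary part is dual to it. -/
theorem sigmaTensor_eq_zero_iff (h : IsUnitaryPairOn g U O) (hy : y ∈ O) :
    (∀ c a b, sigmaTensor g U y c a b = 0) ↔
      ∀ c, umbilicAt (g y) (U y) (covMatrix g U y) c = 0 := by
  have hr : ((1 / Real.sqrt 2 : ℝ) : ℂ) ≠ 0 := by
    rw [Ne, Complex.ofReal_eq_zero]
    positivity
  constructor
  · intro hS c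
    ext a b
    have h1 := hS c a b
    rw [h.sigmaTensor_eq hy, mul_eq_zero] at h1
    have h2 := congrArg Complex.re (h1.resolve_left hr)
    simpa using h2
  · intro hX c a b
    rw [h.sigmaTensor_eq hy, hX, hodgeAt_zero]
    simp

/-- The Leibniz rule for `A = e^φ (cos ψ U + sin ψ *U)`. -/
theorem covMatrix_canonicalForm (h : IsUnitaryPairOn g U O) (hy : y ∈ O) {φ ψ : Coord → ℝ}
    (hφ : DifferentiableAt ℝ φ y) (hψ : DifferentiableAt ℝ ψ y) (c : Fin 4) :
    covMatrix g (canonicalForm g U φ ψ) y c =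
      Real.exp (φ y) • covCanonicalAt (g y) (U y) (covMatrix g U y) (Real.cos (ψ y))
        (Real.sin (ψ y)) (fun k => pd φ k y) (fun k => pd ψ k y) c := by
  have hU := fun a b => (h.form hy a b).differentiableAt (by simp)
  have hV := fun a b => (h.dual hy a b).differentiableAt (by simp)
  have hpd : pdMatrix (canonicalForm g U φ ψ) y c = Real.exp (φ y) •
      (Real.cos (ψ y) • (pd φ c y • U y + pd ψ c y • hodge2 g U y + pdMatrix U y c) +
        Real.sin (ψ y) • (pd φ c y • hodge2 g U y - pd ψ c y • U y +
          pdMatrix (hodge2 g U) y c)) := by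
    ext a b
    have hd : DifferentiableAt ℝ (fun z => canonicalForm g U φ ψ z a b) y :=
      (hφ.exp).mul (((hψ.cos).mul (hU a b)).add ((hψ.sin).mul (hV a b)))
    have h1 := (hasDerivAt_line_of_differentiableAt hφ c).exp.mul
      (((hasDerivAt_line_of_differentiableAt hψ c).cos.mul
        (hasDerivAt_line_of_differentiableAt (hU a b) c)).add
      ((hasDerivAt_line_of_differentiableAt hψ c).sin.mul
        (hasDerivAt_line_of_differentiableAt (hV a b) c)))
    have h2 := (hasDerivAt_line_of_differentiableAt hd c).unique h1
    rw [pdMatrix, Matrix.of_apply, h2]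
    simp only [zero_smul, add_zero, Pi.add_apply, Pi.mul_apply, Matrix.smul_apply, Matrix.add_apply,
      Matrix.sub_apply, smul_eq_mul, pdMatrix, Matrix.of_apply]
    ring
  have h1 := pdMatrix_eq g (canonicalForm g U φ ψ) y c
  have h2 := pdMatrix_eq g U y c
  have h3 := pdMatrix_eq g (hodge2 g U) y c
  rw [h.covMatrix_dual hy] at h3
  rw [hpd, h2, h3] at h1
  have h4 := eq_sub_of_add_eq' h1.symm
  rw [h4, covCanonicalAt, ← hodge2_apply]
  simp only [canonicalForm, Matrix.mul_smul, Matrix.smul_mul, Matrix.mul_add, Matrix.add_mul]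
  module

end IsUnitaryPairOn

/-! ### Smoothness and local integration of `Φ` -/

theorem contDiffAt_pd {f : Coord → ℝ} {y : Coord} (hf : ContDiffAt ℝ ∞ f y) (c : Fin 4) :
    ContDiffAt ℝ ∞ (pd f c) y :=
  (hf.fderiv_right (m := ∞) (by simp)).clm_apply contDiffAt_const

theorem contDiffAt_codiff {g F : Tensor2} {y : Coord}
    (hg : ∀ a b, ContDiffAt ℝ ∞ (fun z => g z a b) y)
    (hF : ∀ a b, ContDiffAt ℝ ∞ (fun z => F z a b) y) (hu : IsUnit (g y).det) (d : Fin 4) :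
    ContDiffAt ℝ ∞ (fun z => codiff g F z d) y := by
  have hi := contDiffAt_inv hg hu
  have hH := fun a b => contDiffAt_hodgeAt hg hF hu a b
  have hβ : ∀ a b c, ContDiffAt ℝ ∞ (fun z => extDeriv2 (hodge2 g F) z a b c) y := fun a b c =>
    ((contDiffAt_pd (hH b c) a).add (contDiffAt_pd (hH c a) b)).add (contDiffAt_pd (hH a b) c)
  simp only [codiff, hodge3]
  exact contDiffAt_const.mul (ContDiffAt.sum fun a _ => ContDiffAt.sum fun b _ =>
    ContDiffAt.sum fun c _ => (ContDiffAt.sum fun p _ => ContDiffAt.sum fun q _ =>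
      ContDiffAt.sum fun r _ => (((hi a p).mul (hi b q)).mul (hi c r)).mul (hβ p q r)).mul
        ((contDiffAt_sqrt_det hg hu).mul contDiffAt_const))

theorem contDiffAt_interior {g T : Tensor2} {α : OneForm} {y : Coord}
    (hg : ∀ a b, ContDiffAt ℝ ∞ (fun z => g z a b) y)
    (hT : ∀ a b, ContDiffAt ℝ ∞ (fun z => T z a b) y)
    (hα : ∀ a, ContDiffAt ℝ ∞ (fun z => α z a) y) (hu : IsUnit (g y).det) (b : Fin 4) :
    ContDiffAt ℝ ∞ (fun z => interior g α T z b) y := by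
  have hi := contDiffAt_inv hg hu
  exact ContDiffAt.sum fun a _ => (ContDiffAt.sum fun p _ => (hi a p).mul (hα p)).mul (hT a b)

theorem IsUnitaryPairOn.contDiffAt_phiForm {g U : Tensor2} {O : Set Coord} {y : Coord}
    (h : IsUnitaryPairOn g U O) (hy : y ∈ O) (b : Fin 4) :
    ContDiffAt ℝ ∞ (fun z => phiForm g U z b) y := by
  have hu := (h.frame y hy).isUnit_det
  exact (contDiffAt_interior (h.metric hy) (h.form hy)
    (contDiffAt_codiff (h.metric hy) (h.form hy) hu) hu b).sub
    (contDiffAt_interior (h.metric hy) (h.dual hy)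
    (contDiffAt_codiff (h.metric hy) (h.dual hy) hu) hu b)

theorem coord_eq_sum (v : Coord) : v = ∑ a, v a • coordVec a := by
  ext i
  simp [coordVec, Pi.single_apply]

/-- The Poincaré lemma for smooth 1-forms in a coordinate domain. -/
theorem exists_local_primitive {O : Set Coord} (hO : IsOpen O) {θ : OneForm}
    (hθ : ∀ y ∈ O, ∀ a, ContDiffAt ℝ ∞ (fun z => θ z a) y)
    (hd : ∀ y ∈ O, ∀ a b, pd (fun z => θ z b) a y - pd (fun z => θ z a) b y = 0)
    {y : Coord} (hy : y ∈ O) :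
    ∃ W, IsOpen W ∧ y ∈ W ∧ W ⊆ O ∧ ∃ φ : Coord → ℝ, ContDiffOn ℝ ∞ φ W ∧
      ∀ z ∈ W, ∀ a, pd φ a z = θ z a := by
  obtain ⟨ε, hε, hball⟩ := Metric.isOpen_iff.mp hO y hy
  let L : Coord → Coord →L[ℝ] ℝ := fun z => ∑ a, θ z a • (EuclideanSpace.proj a : Coord →L[ℝ] ℝ)
  have hL : ∀ z ∈ O, ContDiffAt ℝ ∞ L z := fun z hz =>
    ContDiffAt.sum fun a _ => (hθ z hz a).smul contDiffAt_const
  have hLd : ∀ z ∈ O, HasFDerivAt L (∑ a, (fderiv ℝ (fun z => θ z a) z).smulRight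
      (EuclideanSpace.proj a : Coord →L[ℝ] ℝ)) z := fun z hz =>
    HasFDerivAt.fun_sum fun a _ =>
      ((hθ z hz a).differentiableAt (by simp)).hasFDerivAt.smul_const
        (EuclideanSpace.proj a : Coord →L[ℝ] ℝ)
  have hfd : ∀ z, ∀ a, ∀ v : Coord, fderiv ℝ (fun z => θ z a) z v =
      ∑ b, v b * pd (fun z => θ z a) b z := by
    intro z a v
    conv_lhs => rw [coord_eq_sum v]
    simp [pd]
  obtain ⟨φ, hφ⟩ := (convex_ball y ε).exists_forall_hasFDerivWithinAt_of_hasFDerivWithinAt_symmetric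
    (fun z hz => (hLd z (hball hz)).hasFDerivWithinAt) (by
      intro z hz u _ v _
      have hproj : ∀ (i : Fin 4) (v : Coord), (EuclideanSpace.proj i : Coord →L[ℝ] ℝ) v = v i :=
        fun i v => rfl
      simp only [_root_.sum_apply, ContinuousLinearMap.smulRight_apply, hfd,
        _root_.smul_apply, smul_eq_mul, Finset.sum_mul, hproj]
      rw [Finset.sum_comm]
      refine Finset.sum_congr rfl fun a _ => Finset.sum_congr rfl fun b _ => ?_
      linear_combination u a * v b * hd z (hball hz) a b)
  have hφ' : ∀ z ∈ Metric.ball y ε, HasFDerivAt φ (L z) z := fun z hz =>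
    (hφ z hz).hasFDerivAt (Metric.isOpen_ball.mem_nhds hz)
  refine ⟨Metric.ball y ε, Metric.isOpen_ball, Metric.mem_ball_self hε, hball, φ, ?_, ?_⟩
  · rw [contDiffOn_infty_iff_fderiv_of_isOpen Metric.isOpen_ball]
    refine ⟨fun z hz => (hφ' z hz).differentiableAt.differentiableWithinAt, ?_⟩
    exact ContDiffOn.congr (fun z hz => (hL z (hball hz)).contDiffWithinAt)
      fun z hz => (hφ' z hz).fderiv
  · intro z hz a
    rw [pd, (hφ' z hz).fderiv]
    simp [L, coordVec]

/-- A closed `Φ[U]` has local potentials. -/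
theorem IsUnitaryPairOn.exists_energeticIndex {g U : Tensor2} {O : Set Coord} {y : Coord}
    (h : IsUnitaryPairOn g U O) (hy : y ∈ O)
    (hd : ∀ y ∈ O, ∀ a b,
      pd (fun z => phiForm g U z b) a y - pd (fun z => phiForm g U z a) b y = 0) :
    ∃ W : Set Coord, IsOpen W ∧ y ∈ W ∧ W ⊆ O ∧ ∃ φ, IsEnergeticIndexOn g U W φ := by
  obtain ⟨W, hW, hyW, hWO, φ, hφ, hφd⟩ := exists_local_primitive h.isOpen
    (θ := fun z a => phiForm g U z a) (fun z hz a => h.contDiffAt_phiForm hz a) hd hy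
  refine ⟨W, hW, hyW, hWO, fun z => (-1 / 2) * φ z, contDiffOn_const.mul hφ, fun z hz a => ?_⟩
  have hdz : DifferentiableAt ℝ φ z :=
    (hφ.contDiffAt (hW.mem_nhds hz)).differentiableAt (by simp)
  have h1 : pd (fun z => (-1 / 2) * φ z) a z = (-1 / 2) * pd φ a z := by
    rw [pd, fderiv_const_mul hdz]
    rfl
  rw [h1, hφd z hz a]
  ring

/-! ### Determinations of `ψ` -/

/-- Where `cos ψ δU + sin ψ δ*U = 0`, the codifferentials are proportional. -/
theorem wedge_eq_zero_of_comb {p q : Fin 4 → ℝ} {C s : ℝ} (hCs : C ^ 2 + s ^ 2 = 1)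
    (h : ∀ d, C * p d + s * q d = 0) (a b : Fin 4) : p a * q b - p b * q a = 0 := by
  linear_combination (-(p a * q b - p b * q a)) * hCs + (C * q b - s * p b) * h a +
    (s * p a - C * q a) * h b

/-- Conversely `tan ψ = - i(x)δU / i(x)δ*U` makes the combination vanish, by proportionality. -/
theorem comb_eq_zero_of_negArctan {p q x : Fin 4 → ℝ}
    (hw : ∀ a b, p a * q b - p b * q a = 0)
    (hx : ∑ a, x a * p a ≠ 0 ∨ ∑ a, x a * q a ≠ 0) {θ : ℝ} {n : ℤ}
    (hθ : θ = negArctan (∑ a, x a * p a) (∑ a, x a * q a) + n * Real.pi) (d : Fin 4) :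
    Real.cos θ * p d + Real.sin θ * q d = 0 := by
  set P := ∑ a, x a * p a with hP
  set Q := ∑ a, x a * q a with hQ
  have hPQ : P * q d = p d * Q := by
    rw [hP, hQ, Finset.sum_mul, Finset.mul_sum]
    refine Finset.sum_congr rfl fun a _ => ?_
    linear_combination x a * hw a d
  have hcomb : Real.cos θ * P + Real.sin θ * Q = 0 := by
    rw [hθ, Real.cos_add_int_mul_pi, Real.sin_add_int_mul_pi]
    by_cases h0 : Q = 0
    · simp [negArctan, h0]
    · rw [negArctan, if_neg h0, Real.cos_neg, Real.sin_neg]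
      have h1 : Real.sin (Real.arctan (P / Q)) * Q = P * Real.cos (Real.arctan (P / Q)) := by
        have h2 := Real.tan_arctan (P / Q)
        rw [Real.tan_eq_sin_div_cos, div_eq_div_iff (Real.cos_arctan_pos _).ne' h0] at h2
        exact h2
      linear_combination -((-1) ^ n : ℝ) * h1
  by_cases h0 : Q = 0
  · have hP0 : P ≠ 0 := hx.resolve_right (by simpa using h0)
    have hq : q d = 0 := by
      rw [h0, mul_zero] at hPQ
      exact (mul_eq_zero.mp hPQ).resolve_left hP0
    have hc : Real.cos θ = 0 := by
      rw [h0, mul_zero, add_zero] at hcomb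
      exact (mul_eq_zero.mp hcomb).resolve_right hP0
    rw [hc, hq]
    ring
  · refine (mul_eq_zero.mp (?_ : Q * _ = 0)).resolve_left h0
    linear_combination q d * hcomb - Real.cos θ * hPQ

/-- An angle that annihilates the combination is a value of `ψ[U]` modulo `π`. -/
theorem exists_negArctan_of_comb {P Q θ : ℝ} (hPQ : P ≠ 0 ∨ Q ≠ 0)
    (h : Real.cos θ * P + Real.sin θ * Q = 0) :
    ∃ n : ℤ, θ = negArctan P Q + n * Real.pi := by
  by_cases h0 : Q = 0
  · have hP0 : P ≠ 0 := hPQ.resolve_right (by simpa using h0)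
    rw [h0, mul_zero, add_zero] at h
    obtain ⟨k, hk⟩ := Real.cos_eq_zero_iff.mp ((mul_eq_zero.mp h).resolve_right hP0)
    refine ⟨k, ?_⟩
    rw [negArctan, if_pos h0, hk]
    ring
  · have hs : Real.sin (θ + Real.arctan (P / Q)) = 0 := by
      rw [Real.sin_add]
      have h2 := Real.tan_arctan (P / Q)
      rw [Real.tan_eq_sin_div_cos, div_eq_div_iff (Real.cos_arctan_pos _).ne' h0] at h2
      refine (mul_eq_zero.mp (?_ : Q * _ = 0)).resolve_left h0
      linear_combination Real.cos θ * h2 + Real.cos (Real.arctan (P / Q)) * h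
    obtain ⟨k, hk⟩ := Real.sin_eq_zero_iff.mp hs
    refine ⟨k, ?_⟩
    rw [negArctan, if_neg h0, hk]
    ring

/-- Two functions that annihilate the same pair of 1-forms, which do not vanish simultaneously,
differ by multiples of `π` and therefore have the same differential. -/
theorem pd_eq_of_comb {ψ ψ' : Coord → ℝ} {p q : OneForm} {y : Coord}
    (hψ : DifferentiableAt ℝ ψ y) (hψ' : DifferentiableAt ℝ ψ' y)
    (h : ∀ᶠ z in 𝓝 y, ∀ d, Real.cos (ψ z) * p z d + Real.sin (ψ z) * q z d = 0)
    (h' : ∀ᶠ z in 𝓝 y, ∀ d, Real.cos (ψ' z) * p z d + Real.sin (ψ' z) * q z d = 0)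
    (hne : ∀ᶠ z in 𝓝 y, ∃ d, p z d ≠ 0 ∨ q z d ≠ 0) (a : Fin 4) : pd ψ' a y = pd ψ a y := by
  have hsin : (fun z => Real.sin (ψ' z - ψ z)) =ᶠ[𝓝 y] fun _ => 0 := by
    filter_upwards [h, h', hne] with z h1 h2 ⟨d, hd⟩
    rw [Real.sin_sub]
    rcases hd with hd | hd
    · refine (mul_eq_zero.mp (?_ : p z d * _ = 0)).resolve_left hd
      linear_combination Real.sin (ψ' z) * h1 d - Real.sin (ψ z) * h2 d
    · refine (mul_eq_zero.mp (?_ : q z d * _ = 0)).resolve_left hd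
      linear_combination Real.cos (ψ z) * h2 d - Real.cos (ψ' z) * h1 d
  have h1 : pd (fun z => Real.sin (ψ' z - ψ z)) a y =
      Real.cos (ψ' y - ψ y) * (pd ψ' a y - pd ψ a y) := by
    rw [pd, (hψ'.hasFDerivAt.fun_sub hψ.hasFDerivAt).sin.fderiv]
    rfl
  have h0 : pd (fun _ : Coord => (0 : ℝ)) a y = 0 := by simp [pd]
  rw [pd_congr hsin, h0] at h1
  have hs := hsin.self_of_nhds
  have hc : Real.cos (ψ' y - ψ y) ≠ 0 := by
    intro hc
    have := Real.sin_sq_add_cos_sq (ψ' y - ψ y)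
    rw [hc, show Real.sin (ψ' y - ψ y) = 0 from hs] at this
    norm_num at this
  exact sub_eq_zero.mp ((mul_eq_zero.mp h1.symm).resolve_left hc)

/-! ### Killing-Yano tensors in a chart -/

namespace IsUnitaryPairOn

variable {g U : Tensor2} {O W : Set Coord} {y : Coord} {φ ψ : Coord → ℝ}

/-- The Killing-Yano equation for `e^φ (cos ψ U + sin ψ *U)` determines `dφ` and `dψ` and makes `U`
umbilical. -/
theorem of_isKillingYanoOn (h : IsUnitaryPairOn g U O) (hW : IsOpen W) (hWO : W ⊆ O)
    (hφ : ContDiffOn ℝ ∞ φ W) (hψ : ContDiffOn ℝ ∞ ψ W)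
    (hK : IsKillingYanoOn g (canonicalForm g U φ ψ) W) (hy : y ∈ W) :
    (∀ a, -2 * pd φ a y = phiForm g U y a) ∧ (∀ a, 2 * pd ψ a y + psiForm g U y a = 0) ∧
      (∀ c, umbilicAt (g y) (U y) (covMatrix g U y) c = 0) ∧
      ∀ d, Real.cos (ψ y) * codiff g U y d + Real.sin (ψ y) * codiff g (hodge2 g U) y d = 0 := by
  have hyO := hWO hy
  have hdφ := (hφ.contDiffAt (hW.mem_nhds hy)).differentiableAt (by simp)
  have hdψ := (hψ.contDiffAt (hW.mem_nhds hy)).differentiableAt (by simp)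
  have hkill : IsKillingAt (covCanonicalAt (g y) (U y) (covMatrix g U y) (Real.cos (ψ y))
      (Real.sin (ψ y)) (fun k => pd φ k y) fun k => pd ψ k y) := by
    intro c a b
    have h1 : covMatrix g (canonicalForm g U φ ψ) y c a b +
      covMatrix g (canonicalForm g U φ ψ) y a c b = 0 := hK.killing y hy c a b
    rw [h.covMatrix_canonicalForm hyO hdφ hdψ, h.covMatrix_canonicalForm hyO hdφ hdψ,
      Matrix.smul_apply, Matrix.smul_apply, smul_eq_mul, smul_eq_mul, ← mul_add] at h1
    exact (mul_eq_zero.mp h1).resolve_left (Real.exp_pos _).ne'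
  obtain ⟨r1, r2, r3, r4⟩ := (h.frame y hyO).of_isKillingAt (h.cov_skew hyO)
    (h.pairing_cov_form hyO) (h.pairing_cov_dual hyO) (Real.cos_sq_add_sin_sq _) hkill
  rw [← h.phiForm_eq hyO] at r1
  rw [← h.psiForm_eq hyO] at r2
  rw [← h.codiff_form hyO, ← h.codiff_dual hyO] at r4
  refine ⟨fun a => ?_, fun a => ?_, congrFun r3, congrFun r4⟩
  · have h1 : 2 • pd φ a y + phiForm g U y a = 0 := congrFun r1 a
    rw [nsmul_eq_mul, Nat.cast_ofNat] at h1
    linarith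
  · have h1 : 2 • pd ψ a y + psiForm g U y a = 0 := congrFun r2 a
    rw [nsmul_eq_mul, Nat.cast_ofNat] at h1
    linarith

/-- The equations at each point, together with `-2 dφ = Φ`, give a Killing-Yano tensor. -/
theorem isKillingYanoOn (h : IsUnitaryPairOn g U O) (hW : IsOpen W) (hWO : W ⊆ O)
    (hφ : ContDiffOn ℝ ∞ φ W) (hψ : ContDiffOn ℝ ∞ ψ W)
    (h1 : ∀ y ∈ W, ∀ a, -2 * pd φ a y = phiForm g U y a)
    (h2 : ∀ y ∈ W, ∀ a, 2 * pd ψ a y + psiForm g U y a = 0)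
    (h3 : ∀ y ∈ W, ∀ c, umbilicAt (g y) (U y) (covMatrix g U y) c = 0)
    (h4 : ∀ y ∈ W, ∀ d,
      Real.cos (ψ y) * codiff g U y d + Real.sin (ψ y) * codiff g (hodge2 g U) y d = 0) :
    IsKillingYanoOn g (canonicalForm g U φ ψ) W := by
  refine ⟨fun a b => ?_, fun y hy a b => ?_, fun y hy a b c => ?_⟩
  · exact hφ.exp.mul ((hψ.cos.mul ((h.smooth_form a b).mono hWO)).add
      (hψ.sin.mul fun y hy => (h.dual (hWO hy) a b).contDiffWithinAt))
  · have e1 := skew_of_transpose (h.frame y (hWO hy)).transpose_form a b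
    have e2 : hodge2 g U y a b = - hodge2 g U y b a := hodgeAt_skew _ _ _ _
    simp only [canonicalForm, Matrix.smul_apply, Matrix.add_apply, smul_eq_mul, e1, e2]
    ring
  · have hyO := hWO hy
    have hdφ := (hφ.contDiffAt (hW.mem_nhds hy)).differentiableAt (by simp)
    have hdψ := (hψ.contDiffAt (hW.mem_nhds hy)).differentiableAt (by simp)
    have hk := (h.frame y hyO).isKillingAt (T := covMatrix g U y) (C := Real.cos (ψ y))
      (s := Real.sin (ψ y)) (a := fun k => pd φ k y) (b := fun k => pd ψ k y)
      (fun c => by rw [← h.phiForm_eq hyO, ← h1 y hy]; ring)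
      (fun c => by rw [← h.psiForm_eq hyO, h2 y hy]) (h3 y hy)
      (fun d => by rw [← h.codiff_form hyO, ← h.codiff_dual hyO, h4 y hy]) a b c
    change covMatrix g (canonicalForm g U φ ψ) y a b c +
      covMatrix g (canonicalForm g U φ ψ) y b a c = 0
    rw [h.covMatrix_canonicalForm hyO hdφ hdψ, h.covMatrix_canonicalForm hyO hdφ hdψ,
      Matrix.smul_apply, Matrix.smul_apply, smul_eq_mul, smul_eq_mul, ← mul_add, hk, mul_zero]

/-- A 2-form `e^φ (cos ψ U + sin ψ *U)` is regular, because its two invariants are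
`-2 e^{2φ} cos 2ψ` and `2 e^{2φ} sin 2ψ`. -/
theorem isRegularOn (h : IsUnitaryPairOn g U O) (hWO : W ⊆ O) (φ ψ : Coord → ℝ) :
    IsRegularOn g (canonicalForm g U φ ψ) W := by
  intro y hy
  have hfr := h.frame y (hWO hy)
  set G := g y
  set V := hodgeAt G (U y) with hV
  set E := Real.exp (φ y) with hE
  set C := Real.cos (ψ y)
  set s := Real.sin (ψ y)
  have hA : canonicalForm g U φ ψ y = E • (C • U y + s • V) := rfl
  have hVA : hodgeAt G (E • (C • U y + s • V)) = E • (C • V + s • -(U y)) := by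
    rw [hodgeAt_smul, hodgeAt_add, hodgeAt_smul, hodgeAt_smul,
      hfr.hodgeAt_hodgeAt hfr.transpose_form]
  change pairing G (canonicalForm g U φ ψ y) (canonicalForm g U φ ψ y) ≠ 0 ∨
    pairing G (canonicalForm g U φ ψ y) (hodgeAt G (canonicalForm g U φ ψ y)) ≠ 0
  rw [hA, hVA]
  have hneg : ∀ A B, pairing G A (-B) = - pairing G A B := fun A B => by
    rw [← neg_one_smul ℝ B, pairing_smul_right, neg_one_mul]
  simp only [pairing_smul_left, pairing_smul_right, pairing_add_left, pairing_add_right, hneg]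
  rw [hfr.pairing_self, hfr.pairing_dual, hfr.pairing_dual_self, hfr.pairing_dual_dual]
  by_contra! hcon
  obtain ⟨e1, e2⟩ := hcon
  have hE0 : E ^ 2 ≠ 0 := pow_ne_zero 2 (Real.exp_pos _).ne'
  have hCs : C ^ 2 + s ^ 2 = 1 := Real.cos_sq_add_sin_sq _
  have f1 : C ^ 2 - s ^ 2 = 0 := (mul_eq_zero.mp (by linear_combination (-1 / 2) * e1 :
    E ^ 2 * (C ^ 2 - s ^ 2) = 0)).resolve_left hE0
  have f2 : C * s = 0 := (mul_eq_zero.mp (by linear_combination (1 / 4) * e2 :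
    E ^ 2 * (C * s) = 0)).resolve_left hE0
  rcases mul_eq_zero.mp f2 with h0 | h0 <;> rw [h0] at f1 hCs <;> nlinarith

theorem comb_of_isRainichIndexOn (hWd : ∀ y ∈ W, ∀ a b,
      codiff g U y a * codiff g (hodge2 g U) y b - codiff g U y b * codiff g (hodge2 g U) y a = 0)
    {x : Coord → Fin 4 → ℝ} (hψ : IsRainichIndexOn g U W x ψ) (hy : y ∈ W) (d : Fin 4) :
    Real.cos (ψ y) * codiff g U y d + Real.sin (ψ y) * codiff g (hodge2 g U) y d = 0 := by
  obtain ⟨n, hn⟩ := hψ.eq_negArctan y hy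
  exact comb_eq_zero_of_negArctan (hWd y hy) (hψ.ne_zero y hy) hn d

/-- The angle of a Killing-Yano tensor is a determination of `ψ[U]`. The vectors `x` need not depend
continuously on the point, so coordinate vectors suffice. -/
theorem exists_isRainichIndexOn (hψ : ContDiffOn ℝ ∞ ψ W)
    (hne : ∀ y ∈ W, ∃ d, codiff g U y d ≠ 0 ∨ codiff g (hodge2 g U) y d ≠ 0)
    (hcomb : ∀ y ∈ W, ∀ d,
      Real.cos (ψ y) * codiff g U y d + Real.sin (ψ y) * codiff g (hodge2 g U) y d = 0) :
    ∃ x, IsRainichIndexOn g U W x ψ := by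
  have hex : ∀ y, ∃ d, y ∈ W → codiff g U y d ≠ 0 ∨ codiff g (hodge2 g U) y d ≠ 0 := by
    intro y
    by_cases hy : y ∈ W
    · obtain ⟨d, hd⟩ := hne y hy
      exact ⟨d, fun _ => hd⟩
    · exact ⟨0, fun h => absurd h hy⟩
  choose d hd using hex
  have hsum : ∀ y (p : Fin 4 → ℝ), ∑ a, (Pi.single (d y) 1 : Fin 4 → ℝ) a * p a = p (d y) := by
    intro y p
    simp [Pi.single_apply]
  refine ⟨fun y => Pi.single (d y) 1, hψ, fun y hy => ?_, fun y hy => ?_⟩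
  · rw [hsum, hsum]
    exact hd y hy
  · rw [hsum, hsum]
    exact exists_negArctan_of_comb (hd y hy) (hcomb y hy (d y))

/-- For an umbilical structure `∇U` vanishes exactly where `δU` and `δ*U` both do. -/
theorem cov_ne_zero_iff (h : IsUnitaryPairOn g U O) (hy : y ∈ O)
    (hX : ∀ c, umbilicAt (g y) (U y) (covMatrix g U y) c = 0) :
    (∃ c a b, cov g U y c a b ≠ 0) ↔
      ∃ d, codiff g U y d ≠ 0 ∨ codiff g (hodge2 g U) y d ≠ 0 := by
  rw [← not_iff_not]
  push Not
  constructor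
  · intro hT d
    have hT' : ∀ c, covMatrix g U y c = 0 := fun c => by
      ext a b
      exact hT c a b
    rw [h.codiff_form hy, h.codiff_dual hy]
    exact ⟨negDiv_zero _ hT' d, negDiv_zero _ (fun c => by rw [hT', hodgeAt_zero]) d⟩
  · intro hpq c a b
    have hp : negDiv (g y) (covMatrix g U y) = 0 := by
      rw [← h.codiff_form hy]
      exact funext fun d => (hpq d).1
    have hq : negDiv (g y) (fun c => hodgeAt (g y) (covMatrix g U y c)) = 0 := by
      rw [← h.codiff_dual hy]
      exact funext fun d => (hpq d).2
    have hX1 := congrFun (congrFun (hX c) a) b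
    simp only [umbilicAt, phiAt, psiAt, hp, hq, interiorAt, Matrix.mulVec_zero, Matrix.zero_vecMul,
      wedgeMetric_zero, hodgeAt_zero] at hX1
    have hT : covMatrix g U y c a b = 0 := by simpa using hX1
    exact hT

end IsUnitaryPairOn

/-! ### The components of the fields in a chart -/

theorem bilin_eq_dotProduct (B : Coord →ₗ[ℝ] Coord →ₗ[ℝ] ℝ) (v v' : Coord) :
    B v v' = (WithLp.ofLp v) ⬝ᵥ
      (Matrix.of fun a b => B (coordVec a) (coordVec b)) *ᵥ (WithLp.ofLp v') := by
  conv_lhs => rw [coord_eq_sum v, coord_eq_sum v']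
  simp only [map_sum, map_smul, LinearMap.sum_apply, LinearMap.smul_apply, smul_eq_mul,
    dotProduct, Matrix.mulVec, Matrix.of_apply, Finset.mul_sum]
  rw [Finset.sum_comm]
  refine Finset.sum_congr rfl fun a _ => Finset.sum_congr rfl fun b _ => ?_
  ring

section Manifold

variable {M : Type*} [TopologicalSpace M] [ChartedSpace Coord M] [IsManifold (𝓡 4) ∞ M]

/-- In a chart, orthonormal vectors pull back to orthonormal vectors of the coordinate space, so
the components of a unitary 2-form have adapted frames. -/
theorem isUnitaryPairOn_comp {g U : BilinField M} (hg : IsLorentzMetric g)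
    (hU : IsUnitaryTwoForm g U) {e : OpenPartialHomeomorph M Coord} (he : e ∈ atlas Coord M) :
    IsUnitaryPairOn (comp e g) (comp e U) e.target := by
  have : IsManifold (𝓡 4) 1 M := IsManifold.of_le (n := ∞) (by simp)
  refine ⟨e.open_target, hg.smooth e he, hU.smooth e he, fun y hy => ?_⟩
  have hmd : e.MDifferentiable (𝓡 4) (𝓡 4) := mdifferentiable_of_mem_atlas he
  set D := mfderiv (𝓡 4) (𝓡 4) e.symm y with hD
  have hsurj : ∀ t : TangentSpace (𝓡 4) (e.symm y), ∃ v : Coord, D v = t := by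
    intro t
    have h1 := hmd.symm_comp_deriv (e.map_target hy)
    rw [e.right_inv hy] at h1
    exact ⟨mfderiv (𝓡 4) (𝓡 4) e (e.symm y) t, congrArg (fun L => L t) h1⟩
  have hval : ∀ (T : BilinField M) (v v' : Coord), T (e.symm y) (D v) (D v') =
      (WithLp.ofLp v) ⬝ᵥ comp e T y *ᵥ (WithLp.ofLp v') := by
    intro T v v'
    have hadd : ∀ v v' : Coord, D (v + v') = D v + D v' := fun v v' => map_add D v v'
    have hsmul : ∀ (r : ℝ) (v : Coord), D (r • v) = r • D v := fun r v => map_smul D r v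
    exact bilin_eq_dotProduct (LinearMap.mk₂ ℝ (fun v v' : Coord => T (e.symm y) (D v) (D v'))
      (fun u v w => by rw [hadd, map_add]; rfl) (fun r u v => by rw [hsmul, map_smul]; rfl)
      (fun u v w => by rw [hadd, map_add]) (fun r u v => by rw [hsmul, map_smul])) v v'
  obtain ⟨b, hb⟩ := hg.signature (e.symm y)
  obtain ⟨u, w, huu, hww, huw, hUuw⟩ := hU.unitary (e.symm y)
  choose β hβ using fun i => hsurj (b i)
  obtain ⟨u', rfl⟩ := hsurj u
  obtain ⟨w', rfl⟩ := hsurj w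
  have hB : (Matrix.of fun a i => β i a)ᵀ * comp e g y * (Matrix.of fun a i => β i a) =
      minkowski := by
    ext i j
    have h1 := hb i j
    rw [← hβ, ← hβ, hval] at h1
    have h2 : ((Matrix.of fun a i => β i a)ᵀ * comp e g y * (Matrix.of fun a i => β i a)) i j =
        (WithLp.ofLp (β i)) ⬝ᵥ comp e g y *ᵥ (WithLp.ofLp (β j)) := by
      rw [Matrix.mul_assoc]
      rfl
    rw [h2, h1, minkowski, Matrix.diagonal_apply]
    fin_cases i <;> simp
  refine hasAdaptedFrame_of_plane hB (WithLp.ofLp u') (WithLp.ofLp w') (by rw [← hval, huu])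
    (by rw [← hval, hww]) (by rw [← hval, huw]) fun a c => ?_
  have hrow : ∀ (v : Coord) a, (WithLp.ofLp v ᵥ* comp e g y) a =
      g (e.symm y) (D v) (D (coordVec a)) := by
    intro v a
    rw [hval, coordVec, Matrix.dotProduct_mulVec]
    simp
  rw [hrow, hrow, hrow, hrow, ← hUuw]
  rfl

end Manifold

/-! ### Killing-Yano structures and the four equations -/

section Global

variable {M : Type*} [TopologicalSpace M] [ChartedSpace Coord M] [IsManifold (𝓡 4) ∞ M]
  {g U : BilinField M}

/-- A Killing-Yano structure satisfies the equations, with `φ` and `ψ` integrating `Φ` and `Ψ`. -/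
theorem equations_of_isKillingYanoStructure (hg : IsLorentzMetric g) (hU : IsUnitaryTwoForm g U)
    (hK : IsKillingYanoStructure g U) (hN : IsNonProduct g U) :
    IsUmbilical g U ∧ PhiClosed g U ∧ CodiffWedgeZero g U ∧ RainichEquation g U := by
  have hX : ∀ e ∈ atlas Coord M, ∀ y ∈ e.target, ∀ c,
      umbilicAt (comp e g y) (comp e U y) (covMatrix (comp e g) (comp e U) y) c = 0 := by
    intro e he y hy
    obtain ⟨W, hW, hyW, hWO, φ, ψ, hφ, hψ, hKY, -⟩ := hK e he y hy
    exact ((isUnitaryPairOn_comp hg hU he).of_isKillingYanoOn hW hWO hφ hψ hKY hyW).2.2.1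
  have hne : ∀ e ∈ atlas Coord M, ∀ y ∈ e.target, ∃ d, codiff (comp e g) (comp e U) y d ≠ 0 ∨
      codiff (comp e g) (hodge2 (comp e g) (comp e U)) y d ≠ 0 := fun e he y hy =>
    ((isUnitaryPairOn_comp hg hU he).cov_ne_zero_iff hy (hX e he y hy)).mp (hN e he y hy)
  have hwedge : CodiffWedgeZero g U := by
    intro e he y hy a b
    obtain ⟨W, hW, hyW, hWO, φ, ψ, hφ, hψ, hKY, -⟩ := hK e he y hy
    exact wedge_eq_zero_of_comb (Real.cos_sq_add_sin_sq (ψ y))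
      ((isUnitaryPairOn_comp hg hU he).of_isKillingYanoOn hW hWO hφ hψ hKY hyW).2.2.2 a b
  refine ⟨fun e he y hy => ((isUnitaryPairOn_comp hg hU he).sigmaTensor_eq_zero_iff hy).mpr
    (hX e he y hy), fun e he y hy a b => ?_, hwedge, fun e he => ⟨fun y hy => ?_, ?_⟩⟩
  · obtain ⟨W, hW, hyW, hWO, φ, ψ, hφ, hψ, hKY, -⟩ := hK e he y hy
    have hΦ : ∀ b, (fun z => phiForm (comp e g) (comp e U) z b) =ᶠ[𝓝 y] fun z => -2 * pd φ b z :=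
      fun b => Filter.mem_of_superset (hW.mem_nhds hyW) fun z hz =>
        (((isUnitaryPairOn_comp hg hU he).of_isKillingYanoOn hW hWO hφ hψ hKY hz).1 b).symm
    have hφy := hφ.contDiffAt (hW.mem_nhds hyW)
    have hpd : ∀ a b, pd (fun z => -2 * pd φ b z) a y =
        -2 * fderiv ℝ (fderiv ℝ φ) y (coordVec a) (coordVec b) := by
      intro a b
      have h2 : DifferentiableAt ℝ (fderiv ℝ φ) y :=
        (hφy.fderiv_right (m := ∞) (by simp)).differentiableAt (by simp)
      have h3 := ((h2.hasFDerivAt.clm_apply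
        (hasFDerivAt_const (coordVec b) y)).const_mul (-2)).fderiv
      change fderiv ℝ (fun z => -2 * fderiv ℝ φ z (coordVec b)) y (coordVec a) = _
      rw [h3]
      simp
    rw [pd_congr (hΦ b), pd_congr (hΦ a), hpd, hpd]
    have hsymm : IsSymmSndFDerivAt ℝ φ y := hφy.isSymmSndFDerivAt (by
      simpa using ENat.LEInfty.out)
    rw [hsymm.eq (coordVec a) (coordVec b), sub_self]
  · obtain ⟨W, hW, hyW, hWO, φ, ψ, hφ, hψ, hKY, -⟩ := hK e he y hy
    obtain ⟨x, hx⟩ := IsUnitaryPairOn.exists_isRainichIndexOn hψ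
      (fun z hz => hne e he z (hWO hz)) fun z hz =>
        ((isUnitaryPairOn_comp hg hU he).of_isKillingYanoOn hW hWO hφ hψ hKY hz).2.2.2
    exact ⟨W, hW, hyW, hWO, x, ψ, hx⟩
  · intro W' hW' hWO' x ψ' hψ' y hy' a
    have hy := hWO' hy'
    obtain ⟨W, hW, hyW, hWO, φ, ψ, hφ, hψ, hKY, -⟩ := hK e he y hy
    have hKYz := fun z (hz : z ∈ W) =>
      (isUnitaryPairOn_comp hg hU he).of_isKillingYanoOn hW hWO hφ hψ hKY hz
    -- Any other determination has the same differential as the angle of the Killing-Yano tensor.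
    have hpd := pd_eq_of_comb (p := codiff (comp e g) (comp e U))
      (q := codiff (comp e g) (hodge2 (comp e g) (comp e U)))
      ((hψ.contDiffAt (hW.mem_nhds hyW)).differentiableAt (by simp))
      ((hψ'.smooth.contDiffAt (hW'.mem_nhds hy')).differentiableAt (by simp))
      (Filter.mem_of_superset (hW.mem_nhds hyW) fun z hz => (hKYz z hz).2.2.2)
      (Filter.mem_of_superset (hW'.mem_nhds hy') fun z hz =>
        IsUnitaryPairOn.comb_of_isRainichIndexOn
          (fun z hz => hwedge e he z (hWO' hz)) hψ' hz)
      (Filter.mem_of_superset (hW'.mem_nhds hy') fun z hz => hne e he z (hWO' hz)) a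
    rw [hpd]
    exact (hKYz y hyW).2.1 a

/-- Solutions of the equations give Killing-Yano tensors. -/
theorem isKillingYanoOn_of_equations (hg : IsLorentzMetric g) (hU : IsUnitaryTwoForm g U)
    (hX : IsUmbilical g U) (hw : CodiffWedgeZero g U) (hR : RainichEquation g U)
    {e : OpenPartialHomeomorph M Coord} (he : e ∈ atlas Coord M) {W : Set Coord} (hW : IsOpen W)
    (hWO : W ⊆ e.target) {φ ψ : Coord → ℝ} {x : Coord → Fin 4 → ℝ}
    (hφ : IsEnergeticIndexOn (comp e g) (comp e U) W φ)
    (hψ : IsRainichIndexOn (comp e g) (comp e U) W x ψ) :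
    IsKillingYanoOn (comp e g) (canonicalForm (comp e g) (comp e U) φ ψ) W ∧
      IsRegularOn (comp e g) (canonicalForm (comp e g) (comp e U) φ ψ) W := by
  have h := isUnitaryPairOn_comp hg hU he
  exact ⟨h.isKillingYanoOn hW hWO hφ.smooth hψ.smooth hφ.eq_phiForm
    ((hR e he).2 W hW hWO x ψ hψ)
    (fun y hy => (h.sigmaTensor_eq_zero_iff (hWO hy)).mp (hX e he y (hWO hy)))
    (fun y hy => IsUnitaryPairOn.comb_of_isRainichIndexOn
      (fun z hz => hw e he z (hWO hz)) hψ hy), h.isRegularOn hWO φ ψ⟩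

/-- The existence of determinations of `ψ[U]` makes the structure non-product. -/
theorem isNonProduct_of_equations (hg : IsLorentzMetric g) (hU : IsUnitaryTwoForm g U)
    (hX : IsUmbilical g U) (hR : RainichEquation g U) : IsNonProduct g U := by
  intro e he y hy
  have h := isUnitaryPairOn_comp hg hU he
  obtain ⟨W, hW, hyW, hWO, x, ψ, hψ⟩ := (hR e he).1 y hy
  refine (h.cov_ne_zero_iff hy ((h.sigmaTensor_eq_zero_iff hy).mp (hX e he y hy))).mpr ?_
  by_contra! hcon
  have h0 := hψ.ne_zero y hyW
  simp [hcon] at h0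

end Global

end KillingYano

theorem mainTheorem2 {M : Type*} [TopologicalSpace M] [ChartedSpace Coord M]
    [IsManifold (𝓡 4) ∞ M] (hM : IsOrientedAtlas M)
    (g U : BilinField M) (hg : IsLorentzMetric g) (hU : IsUnitaryTwoForm g U) :
    ((IsKillingYanoStructure g U ∧ IsNonProduct g U) ↔
      (IsUmbilical g U ∧ PhiClosed g U ∧ CodiffWedgeZero g U ∧ RainichEquation g U)) ∧
    ((IsUmbilical g U ∧ PhiClosed g U ∧ CodiffWedgeZero g U ∧ RainichEquation g U) →
      ∀ e ∈ atlas Coord M,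
        (∀ y ∈ e.target, ∃ W : Set Coord, IsOpen W ∧ y ∈ W ∧ W ⊆ e.target ∧
          ∃ φ, IsEnergeticIndexOn (comp e g) (comp e U) W φ) ∧
        ∀ W : Set Coord, IsOpen W → W ⊆ e.target →
          ∀ φ x ψ, IsEnergeticIndexOn (comp e g) (comp e U) W φ →
            IsRainichIndexOn (comp e g) (comp e U) W x ψ →
              IsKillingYanoOn (comp e g) (canonicalForm (comp e g) (comp e U) φ ψ) W ∧
                IsRegularOn (comp e g) (canonicalForm (comp e g) (comp e U) φ ψ) W) := by
  have hback : IsUmbilical g U ∧ PhiClosed g U ∧ CodiffWedgeZero g U ∧ RainichEquation g U →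
      ∀ e ∈ atlas Coord M, ∀ y ∈ e.target, ∃ W : Set Coord, IsOpen W ∧ y ∈ W ∧ W ⊆ e.target ∧
        ∃ φ, IsEnergeticIndexOn (comp e g) (comp e U) W φ := fun h e he y hy =>
    (isUnitaryPairOn_comp hg hU he).exists_energeticIndex hy (h.2.1 e he)
  refine ⟨⟨fun h => equations_of_isKillingYanoStructure hg hU h.1 h.2, fun h =>
    ⟨fun e he y hy => ?_, isNonProduct_of_equations hg hU h.1 h.2.2.2⟩⟩, fun h e he =>
    ⟨hback h e he, fun W hW hWO φ x ψ hφ hψ =>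
      isKillingYanoOn_of_equations hg hU h.1 h.2.2.1 h.2.2.2 he hW hWO hφ hψ⟩⟩
  obtain ⟨W₁, hW₁, hy₁, hWO₁, φ, hφ⟩ := hback h e he y hy
  obtain ⟨W₂, hW₂, hy₂, hWO₂, x, ψ, hψ⟩ := (h.2.2.2 e he).1 y hy
  have hφ' : IsEnergeticIndexOn (comp e g) (comp e U) (W₁ ∩ W₂) φ :=
    ⟨hφ.smooth.mono Set.inter_subset_left, fun z hz => hφ.eq_phiForm z hz.1⟩
  have hψ' : IsRainichIndexOn (comp e g) (comp e U) (W₁ ∩ W₂) x ψ :=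
    ⟨hψ.smooth.mono Set.inter_subset_right, fun z hz => hψ.ne_zero z hz.2,
      fun z hz => hψ.eq_negArctan z hz.2⟩
  have hWO : W₁ ∩ W₂ ⊆ e.target := fun z hz => hWO₁ hz.1
  exact ⟨W₁ ∩ W₂, hW₁.inter hW₂, ⟨hy₁, hy₂⟩, hWO, φ, ψ, hφ'.smooth, hψ'.smooth,
    isKillingYanoOn_of_equations hg hU h.1 h.2.2.1 h.2.2.2 he (hW₁.inter hW₂) hWO hφ' hψ'⟩
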